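/- Let $N\geq 2$ be an integer, let $s\in(1,N)$ be a real number, and let $m\geq 1$ be an integer with $m\leq s$. Then there exists a curve $E\subset\mathbb{R}^N$ (that is, a continuous image of $[0,1]$) which is Ahlfors $s$-regular, i.e. there are constants $0<c\leq C<\infty$ such that $$c\,r^s\leq \mathcal{H}^s(E\cap B(x,r))\leq C\,r^s\qquad\text{for all }x\in E\text{ and all }0<r\leq \operatorname{diam}E,$$ and which is not contained in any $(m/s)$-Hölder image of $[0,1]^m$: for every map $f:[0,1]^m\to\mathbb{R}^N$ for which there is a finite constant $H$ with $|f(x)-f(y)|\leq H|x-y|^{m/s}$ for all $x,y\in[0,1]^m$, one has $E\not\subset f([0,1]^m)$. Here $\mathcal{H}^s$ is the $s$-dimensional Hausdorff measure and $B(x,r)$ the open ball. -/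

import Mathlib

open MeasureTheory Set
open scoped NNReal ENNReal

/-- A curve: a continuous image of the unit interval `[0,1]`. -/
def IsCurve {X : Type*} [TopologicalSpace X] (E : Set X) : Prop :=
  ∃ γ : unitInterval → X, Continuous γ ∧ range γ = E

/-- Ahlfors `s`-regularity: for some `0 < c ≤ C < ∞`,
`c r ^ s ≤ ℋ^s (E ∩ B(x,r)) ≤ C r ^ s` for all `x ∈ E` and all real `0 < r ≤ diam E`
(the diameter may be infinite). -/
def IsAhlforsRegular {X : Type*} [MetricSpace X] [MeasurableSpace X] [BorelSpace X]
    (s : ℝ) (E : Set X) : Prop :=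
  ∃ c C : ℝ, 0 < c ∧ c ≤ C ∧
    ∀ x ∈ E, ∀ r : ℝ, 0 < r → ENNReal.ofReal r ≤ Metric.ediam E →
      ENNReal.ofReal (c * r ^ s) ≤ μH[s] (E ∩ Metric.ball x r) ∧
        μH[s] (E ∩ Metric.ball x r) ≤ ENNReal.ofReal (C * r ^ s)

/-- The unit cube `[0,1]^m` in `ℝ^m` with the Euclidean metric. -/
def unitCube (m : ℕ) : Set (EuclideanSpace ℝ (Fin m)) :=
  {x | ∀ i, x i ∈ Icc (0 : ℝ) 1}

/-- `Γ` is an `α`-Hölder image of `[0,1]^m`: `Γ = f([0,1]^m)` for a map `f` with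
`|f x - f y| ≤ H |x - y| ^ α` on `[0,1]^m`, for some finite constant `H`. -/
def IsHolderImageOfCube {X : Type*} [MetricSpace X] (m : ℕ) (α : ℝ≥0) (Γ : Set X) : Prop :=
  ∃ (f : EuclideanSpace ℝ (Fin m) → X) (H : ℝ≥0),
    HolderOnWith H α f (unitCube m) ∧ f '' unitCube m = Γ

/-! The curve is a Moran set in the grids of mesh `L ^ (-k)`, built from cubes of two kinds. An
ordinary cube of level `k` keeps the subcubes in `A k`: full vertical columns at even horizontal
positions, so that distinct columns stay apart. A cube is linked once the vertical digits of its
address vanish on a whole block `[2 ^ i - 1, 2 ^ (i + 1) - 1)`, that is, at the bottom of a column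
through that block; from then on it keeps the subcubes in `B k`, a connected pattern. Both patterns
have the same cardinality, with products comparable to `(L ^ k) ^ s`, so a uniform measure shows
Ahlfors regularity.

Linked cubes are frequent enough for connectedness: every column can be descended to its bottom,
which is linked. At each scale the set is therefore a finite union of small connected pieces, and a
metric Hahn–Mazurkiewicz theorem (`isCurve_of_chainConnected`) makes it a curve. They are also rare:
in the coding measure the vertical digits are independent and uniform, a block contains `2 ^ i` of
them, and for `L ≥ 4` the probabilities of a zero block sum to at most `1 / 3`. So the set
`Carpet.fibred` of points in no linked cube has positive measure.

A part of `fibred` of diameter at most `ρ` that is chained by steps shorter than `δ` cannot change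
column, hence lies in a column of width about `δ` and has measure at most `C * ρ * δ ^ (s - 1)`
(`Carpet.hausdorffMeasure_le_of_chainIn`). Let `f` be `(m / s)`-Hölder, `T` the preimage of
`fibred`, and cut a cube of side `l` into `p ^ m` subcubes. If `T` meets all of them, the image of
`T` is chained with `δ` of order `(l / p) ^ (m / s)` and `ρ` of order `l ^ (m / s)`, so its measure
is at most `l ^ m` times a factor that vanishes as `p → ∞`. Otherwise one subcube is lost, and the
argument is repeated in the others. Iterating shows that `f` covers only a null part of `fibred`
(`hausdorffMeasure_inter_holderImage_eq_zero`). -/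

/-! ### Chain connected sets and a metric Hahn–Mazurkiewicz theorem -/

section ChainConnected

variable {X : Type*} [MetricSpace X]

/-- `x` and `y` are joined by a finite sequence of points of `F` with steps shorter than `η`. -/
def ChainIn (F : Set X) (η : ℝ) : X → X → Prop :=
  Relation.ReflTransGen fun a b => a ∈ F ∧ b ∈ F ∧ dist a b < η

/-- A set is chain connected if any two of its points are joined by arbitrarily fine chains. -/
def ChainConnected (F : Set X) : Prop :=
  ∀ η > 0, ∀ x ∈ F, ∀ y ∈ F, ChainIn F η x y

theorem ChainIn.mono {F G : Set X} {η : ℝ} (h : F ⊆ G) {x y : X} (hxy : ChainIn F η x y) :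
    ChainIn G η x y := by
  induction hxy with
  | refl => exact Relation.ReflTransGen.refl
  | tail _ hab ih => exact ih.tail ⟨h hab.1, h hab.2.1, hab.2.2⟩

theorem ChainIn.symm {F : Set X} {η : ℝ} {x y : X} (hxy : ChainIn F η x y) : ChainIn F η y x := by
  induction hxy with
  | refl => exact Relation.ReflTransGen.refl
  | tail _ hab ih => exact ih.head ⟨hab.2.1, hab.1, by rw [dist_comm]; exact hab.2.2⟩

theorem ChainIn.step {F : Set X} {η : ℝ} {x y : X} (hx : x ∈ F) (hy : y ∈ F) (h : dist x y < η) :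
    ChainIn F η x y :=
  Relation.ReflTransGen.single ⟨hx, hy, h⟩

theorem ChainIn.trans {F : Set X} {η : ℝ} {x y z : X} (h₁ : ChainIn F η x y)
    (h₂ : ChainIn F η y z) : ChainIn F η x z :=
  Relation.ReflTransGen.trans h₁ h₂

theorem ChainConnected.union {F G : Set X} (hF : ChainConnected F) (hG : ChainConnected G)
    (h : ∀ η > 0, ∃ u ∈ F, ∃ v ∈ G, dist u v < η) : ChainConnected (F ∪ G) := by
  intro η hη x hx y hy
  obtain ⟨u, hu, v, hv, huv⟩ := h η hη
  have key : ∀ z ∈ F ∪ G, ChainIn (F ∪ G) η u z := by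
    rintro z (hz | hz)
    · exact (hF η hη u hu z hz).mono subset_union_left
    · exact (ChainIn.step (F := F ∪ G) (Or.inl hu) (Or.inr hv) huv).trans
        ((hG η hη v hv z hz).mono subset_union_right)
  exact (key x hx).symm.trans (key y hy)

/-- A set that is, at every scale, a finite union of small chain connected sets is uniformly
locally chain connected. -/
theorem exists_chainConnected_of_dist_lt {E : Set X}
    (h : ∀ ε > 0, ∃ 𝓕 : Set (Set X), 𝓕.Finite ∧ ⋃₀ 𝓕 = E ∧
      ∀ F ∈ 𝓕, ChainConnected F ∧ ∀ x ∈ F, ∀ y ∈ F, dist x y < ε) (ε : ℝ) (hε : 0 < ε) :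
    ∃ δ > 0, ∀ x ∈ E, ∀ y ∈ E, dist x y < δ →
      ∃ G ⊆ E ∩ Metric.ball x ε, ChainConnected G ∧ x ∈ G ∧ y ∈ G := by
  obtain ⟨𝓕, hfin, hcov, hF⟩ := h (ε / 3) (by positivity)
  have hsep : ∀ p ∈ 𝓕 ×ˢ 𝓕, ∃ δ > 0, (∃ u ∈ p.1, ∃ v ∈ p.2, dist u v < δ) →
      ∀ η > 0, ∃ u ∈ p.1, ∃ v ∈ p.2, dist u v < η := by
    intro p _
    by_cases hp : ∀ η > 0, ∃ u ∈ p.1, ∃ v ∈ p.2, dist u v < η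
    · exact ⟨1, one_pos, fun _ => hp⟩
    · push Not at hp
      obtain ⟨δ, hδ, hh⟩ := hp
      refine ⟨δ, hδ, ?_⟩
      rintro ⟨u, hu, v, hv, huv⟩
      exact absurd huv (not_lt.mpr (hh u hu v hv))
  choose! d hd0 hd using hsep
  have hfin2 : (𝓕 ×ˢ 𝓕).Finite := hfin.prod hfin
  obtain ⟨δ, hδ0, hδ⟩ : ∃ δ > 0, ∀ p ∈ 𝓕 ×ˢ 𝓕, δ ≤ d p := by
    rcases (𝓕 ×ˢ 𝓕).eq_empty_or_nonempty with he | hne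
    · exact ⟨1, one_pos, by simp [he]⟩
    · obtain ⟨p, hp, hmin⟩ := Set.exists_min_image _ d hfin2 hne
      exact ⟨d p, hd0 p hp, hmin⟩
  refine ⟨δ, hδ0, fun x hx y hy hxy => ?_⟩
  rw [← hcov] at hx hy
  obtain ⟨F, hF1, hxF⟩ := hx
  obtain ⟨F', hF1', hyF'⟩ := hy
  have hclose := hd (F, F') ⟨hF1, hF1'⟩ ⟨x, hxF, y, hyF', hxy.trans_le (hδ _ ⟨hF1, hF1'⟩)⟩
  refine ⟨F ∪ F', ?_, (hF F hF1).1.union (hF F' hF1').1 hclose, Or.inl hxF, Or.inr hyF'⟩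
  obtain ⟨u, hu, v, hv, huv⟩ := hclose (ε / 3) (by positivity)
  rintro z (hz | hz)
  · refine ⟨hcov ▸ ⟨F, hF1, hz⟩, ?_⟩
    have := (hF F hF1).2 z hz x hxF
    exact Metric.mem_ball.mpr (by linarith)
  · refine ⟨hcov ▸ ⟨F', hF1', hz⟩, ?_⟩
    have h1 := (hF F hF1).2 u hu x hxF
    have h2 := (hF F' hF1').2 z hz v hv
    have h3 := dist_triangle z v x
    have h4 := dist_triangle v u x
    rw [dist_comm v u] at h4
    exact Metric.mem_ball.mpr (by linarith)

/-- There is a walk in `G` from `x` to `y` with steps shorter than `η` that visits `Z`. -/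
def HasTour (G : Set X) (η : ℝ) (Z : Set X) (x y : X) : Prop :=
  ∃ (l : ℕ) (q : ℕ → X), q 0 = x ∧ (∀ r, l ≤ r → q r = y) ∧ (∀ r, q r ∈ G) ∧
    (∀ r, dist (q r) (q (r + 1)) < η) ∧ ∀ z ∈ Z, ∃ r ≤ l, q r = z

theorem HasTour.trans {G : Set X} {η : ℝ} {Z W : Set X} {x y z : X} (h₁ : HasTour G η Z x y)
    (h₂ : HasTour G η W y z) : HasTour G η (Z ∪ W) x z := by
  obtain ⟨l, q, q0, ql, qG, qd, qZ⟩ := h₁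
  obtain ⟨l', q', q0', ql', qG', qd', qZ'⟩ := h₂
  have hl : ∀ r, r ≤ l → (if r < l then q r else q' (r - l)) = q r := by
    intro r hr
    rcases hr.lt_or_eq with h | h
    · simp [h]
    · subst h; simp [q0', ql r le_rfl]
  refine ⟨l + l', fun r => if r < l then q r else q' (r - l), ?_, ?_, ?_, ?_, ?_⟩
  · rw [← q0]; exact hl 0 (Nat.zero_le _)
  · intro r hr
    dsimp only
    rw [if_neg (by omega)]
    exact ql' _ (by omega)
  · intro r
    dsimp only
    split_ifs
    · exact qG r
    · exact qG' _
  · intro r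
    dsimp only
    rcases lt_or_ge r l with h | h
    · rw [hl r h.le, hl (r + 1) h]; exact qd r
    · rw [if_neg (by omega), if_neg (by omega), Nat.sub_add_comm h]; exact qd' _
  · rintro w (hw | hw)
    · obtain ⟨r, hr, rfl⟩ := qZ w hw
      exact ⟨r, by omega, hl r hr⟩
    · obtain ⟨r, hr, rfl⟩ := qZ' w hw
      refine ⟨l + r, by omega, ?_⟩
      simp

theorem ChainIn.hasTour {G : Set X} {η : ℝ} (hη : 0 < η) {x y : X} (hx : x ∈ G)
    (h : ChainIn G η x y) : HasTour G η {y} x y := by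
  induction h with
  | refl => exact ⟨0, fun _ => x, rfl, fun _ _ => rfl, fun _ => hx, by simpa, by simp⟩
  | tail _ hab ih =>
    rename_i a b _
    have : HasTour G η {b} a b := by
      refine ⟨1, fun r => if r = 0 then a else b, rfl, ?_, ?_, ?_, ?_⟩
      · intro r hr; simp [show r ≠ 0 by omega]
      · intro r; dsimp only; split_ifs
        exacts [hab.1, hab.2.1]
      · intro r; dsimp only
        rcases r with _ | r
        · simpa using hab.2.2
        · simpa using hη
      · rintro z rfl; exact ⟨1, le_rfl, by simp⟩
    obtain ⟨l, q, h1, h2, h3, h4, h5⟩ := ih.trans this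
    exact ⟨l, q, h1, h2, h3, h4, fun z hz => h5 z (Or.inr hz)⟩

/-- Visit the points of `Z` one at a time, returning to `x` after each, and finally leave for `y`.
-/
theorem hasTour_of_chainIn {G : Set X} {η : ℝ} (hη : 0 < η) {x y : X} (hx : x ∈ G) (Z : Finset X)
    (hZ : ∀ z ∈ Z, ChainIn G η x z) (hZG : ∀ z ∈ Z, z ∈ G) (hy : ChainIn G η x y) :
    HasTour G η Z x y := by
  classical
  induction Z using Finset.induction_on with
  | empty =>
    obtain ⟨l, q, h1, h2, h3, h4, h5⟩ := hy.hasTour hη hx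
    exact ⟨l, q, h1, h2, h3, h4, by simp⟩
  | insert a Z ha ih =>
    have h1 := (hZ a (by simp)).hasTour hη hx
    have h2 := ((hZ a (by simp)).symm).hasTour hη (hZG a (by simp))
    have h3 := ih (fun z hz => hZ z (by simp [hz])) (fun z hz => hZG z (by simp [hz]))
    obtain ⟨l, q, h1, h2, h3, h4, h5⟩ := (h1.trans h2).trans h3
    refine ⟨l, q, h1, h2, h3, h4, fun z hz => h5 z ?_⟩
    simp only [Finset.coe_insert, mem_insert_iff, Finset.mem_coe, mem_union,
      mem_singleton_iff] at hz ⊢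
    tauto

/-- A finite walk `u 0, …, u T` in `E` with steps shorter than `δ` whose points are `δ`-dense. -/
structure IsDenseWalk (E : Set X) (δ : ℝ) (T : ℕ) (u : ℕ → X) : Prop where
  pos : 0 < T
  mem : ∀ i, u i ∈ E
  step : ∀ i < T, dist (u i) (u (i + 1)) < δ
  dense : ∀ z ∈ E, ∃ i < T, dist z (u i) < δ

theorem exists_isDenseWalk {E : Set X} (hE : IsCompact E) (hne : E.Nonempty)
    (hc : ChainConnected E) {δ : ℝ} (hδ : 0 < δ) : ∃ T u, IsDenseWalk E δ T u := by
  obtain ⟨x, hx⟩ := hne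
  obtain ⟨t, htE, htf, ht⟩ := hE.finite_cover_balls hδ
  obtain ⟨l, q, h1, h2, h3, h4, h5⟩ := hasTour_of_chainIn hδ hx htf.toFinset
    (fun z hz => hc δ hδ x hx z (htE (by simpa using hz)))
    (fun z hz => htE (by simpa using hz)) (hc δ hδ x hx x hx)
  refine ⟨l + 1, q, Nat.succ_pos _, h3, fun i _ => h4 i, fun z hz => ?_⟩
  obtain ⟨w, hw, hzw⟩ := mem_iUnion₂.mp (ht hz)
  obtain ⟨r, hr, rfl⟩ := h5 w (by simpa using hw)
  exact ⟨r, by omega, hzw⟩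

/-- Each step from `u i` to `u (i + 1)` is replaced by a tour through a `δ'`-net of the points of
`E` that are `δ`-close to `u i`. These points can be reached without leaving the `ε`-ball about `u
i`, so the new walk stays close to the old one. -/
theorem IsDenseWalk.refine {E : Set X} (hE : IsCompact E) {δ ε δ' : ℝ} (hε : 0 < ε) (hδ' : 0 < δ')
    (hδ : ∀ x ∈ E, ∀ y ∈ E, dist x y < δ →
      ∃ G ⊆ E ∩ Metric.ball x ε, ChainConnected G ∧ x ∈ G ∧ y ∈ G)
    {T : ℕ} {u : ℕ → X} (hu : IsDenseWalk E δ T u) :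
    ∃ M u', 0 < M ∧ IsDenseWalk E δ' (T * M) u' ∧
      ∀ j ≤ T * M, dist (u' j) (u (j / M)) < ε := by
  have key : ∀ i, ∃ (l : ℕ) (q : ℕ → X), i < T →
      (q 0 = u i ∧ (∀ r, l ≤ r → q r = u (i + 1)) ∧ (∀ r, q r ∈ E ∩ Metric.ball (u i) ε) ∧
        (∀ r, dist (q r) (q (r + 1)) < δ') ∧
        ∀ z ∈ E, dist z (u i) < δ → ∃ r ≤ l, dist z (q r) < δ') := by
    intro i
    by_cases hi : i < T
    swap
    · exact ⟨0, u, fun h => absurd h hi⟩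
    have hnet : ∃ t : Finset X, (∀ z ∈ t, z ∈ E ∧ dist (u i) z < δ) ∧
        ∀ z ∈ E, dist z (u i) < δ → ∃ w ∈ t, dist z w < δ' := by
      have htb : TotallyBounded (E ∩ Metric.ball (u i) δ) :=
        hE.totallyBounded.subset inter_subset_left
      obtain ⟨t, hts, htf, ht⟩ := Metric.finite_approx_of_totallyBounded htb δ' hδ'
      refine ⟨htf.toFinset, fun z hz => ?_, fun z hz hzd => ?_⟩
      · have := hts (htf.mem_toFinset.mp hz)
        exact ⟨this.1, by rw [dist_comm]; exact this.2⟩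
      · obtain ⟨w, hw, hzw⟩ := mem_iUnion₂.mp (ht ⟨hz, hzd⟩)
        exact ⟨w, by simpa using hw, hzw⟩
    obtain ⟨t, ht1, ht2⟩ := hnet
    have hch : ∀ z ∈ E, dist (u i) z < δ →
        z ∈ E ∩ Metric.ball (u i) ε ∧ ChainIn (E ∩ Metric.ball (u i) ε) δ' (u i) z := by
      intro z hz hzd
      obtain ⟨G, hG1, hG2, hG3, hG4⟩ := hδ _ (hu.mem i) z hz hzd
      exact ⟨hG1 hG4, (hG2 δ' hδ' _ hG3 _ hG4).mono hG1⟩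
    obtain ⟨l, q, h1, h2, h3, h4, h5⟩ := hasTour_of_chainIn hδ'
      (show u i ∈ E ∩ Metric.ball (u i) ε from ⟨hu.mem i, Metric.mem_ball_self hε⟩) t
      (fun z hz => (hch z (ht1 z hz).1 (ht1 z hz).2).2)
      (fun z hz => (hch z (ht1 z hz).1 (ht1 z hz).2).1)
      (hch _ (hu.mem (i + 1)) (hu.step i hi)).2
    refine ⟨l, q, fun _ => ⟨h1, h2, h3, h4, fun z hz hzd => ?_⟩⟩
    obtain ⟨w, hw, hzw⟩ := ht2 z hz hzd
    obtain ⟨r, hr, rfl⟩ := h5 w hw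
    exact ⟨r, hr, hzw⟩
  choose l q hq using key
  -- Tours are eventually constant, so all of them can be run for the same number `M` of steps;
  -- index `j` of the new walk then corresponds to `j / M` of the old one.
  let M := (Finset.range T).sup l + 1
  have hM : ∀ i < T, l i < M := fun i hi =>
    Nat.lt_succ_of_le (Finset.le_sup (f := l) (Finset.mem_range.mpr hi))
  have hM0 : 0 < M := Nat.succ_pos _
  let u' : ℕ → X := fun j => if j / M < T then q (j / M) (j % M) else u T
  have hstart : ∀ i ≤ T, u' (M * i) = u i := by
    intro i hi
    simp only [u', Nat.mul_div_cancel_left i hM0, Nat.mul_mod_right]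
    rcases hi.lt_or_eq with h | h
    · rw [if_pos h]; exact (hq i h).1
    · subst h; simp
  have hval : ∀ i < T, ∀ r ≤ M, u' (M * i + r) = q i r := by
    intro i hi r hr
    rcases hr.lt_or_eq with h | h
    · have e1 : (M * i + r) / M = i := by
        rw [Nat.mul_add_div hM0, Nat.div_eq_of_lt h, add_zero]
      have e2 : (M * i + r) % M = r := by
        rw [Nat.mul_add_mod, Nat.mod_eq_of_lt h]
      simp only [u', e1, e2, if_pos hi]
    · rw [h, ← Nat.mul_succ, hstart (i + 1) hi, (hq i hi).2.1 M (hM i hi).le]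
  refine ⟨M, u', hM0, ⟨Nat.mul_pos hu.pos hM0, ?_, ?_, ?_⟩, ?_⟩
  · intro j
    simp only [u']
    split_ifs with h
    · exact ((hq _ h).2.2.1 _).1
    · exact hu.mem T
  · intro j hj
    have hi : j / M < T := Nat.div_lt_of_lt_mul (by rwa [mul_comm])
    have hr : j % M < M := Nat.mod_lt _ hM0
    have e := Nat.div_add_mod j M
    have := (hq _ hi).2.2.2.1 (j % M)
    rw [← hval _ hi _ hr.le, ← hval _ hi _ hr, Nat.add_succ, e] at this
    exact this
  · intro z hz
    obtain ⟨i, hi, hzi⟩ := hu.dense z hz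
    obtain ⟨r, hr, hzr⟩ := (hq i hi).2.2.2.2 z hz hzi
    have hrM : r < M := hr.trans_lt (hM i hi)
    refine ⟨M * i + r, ?_, ?_⟩
    · calc M * i + r < M * i + M := by omega
        _ = (i + 1) * M := by ring
        _ ≤ T * M := Nat.mul_le_mul_right _ hi
    · rwa [hval i hi r hrM.le]
  · intro j hj
    simp only [u']
    split_ifs with h
    · exact ((hq _ h).2.2.1 _).2
    · have h2 : j / M ≤ T := Nat.div_le_of_le_mul (by rwa [mul_comm])
      have : j / M = T := by omega
      rw [this, dist_self]; exact hε

/-- A metric form of the Hahn–Mazurkiewicz theorem. -/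
theorem isCurve_of_chainConnected {E : Set X} (hE : IsCompact E) (hne : E.Nonempty)
    (hc : ChainConnected E)
    (h : ∀ ε > 0, ∃ 𝓕 : Set (Set X), 𝓕.Finite ∧ ⋃₀ 𝓕 = E ∧
      ∀ F ∈ 𝓕, ChainConnected F ∧ ∀ x ∈ F, ∀ y ∈ F, dist x y < ε) : IsCurve E := by
  have hε : ∀ n : ℕ, (0 : ℝ) < 1 / 2 ^ n := fun n => by positivity
  choose d hd0 hd using fun n : ℕ => exists_chainConnected_of_dist_lt h (1 / 2 ^ n) (hε n)
  -- Points closer than `δ n` are joined within distance `2 ^ (-n)`, and the walk of level `n` has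
  -- jumps of at most `2 ^ (-n)`.
  let δ : ℕ → ℝ := fun n => min (d n) (1 / 2 ^ n)
  have hδ0 : ∀ n, 0 < δ n := fun n => lt_min (hd0 n) (hε n)
  have hδε : ∀ n, δ n ≤ 1 / 2 ^ n := fun n => min_le_right _ _
  have href := fun n (p : {p : ℕ × (ℕ → X) // IsDenseWalk E (δ n) p.1 p.2}) =>
    p.2.refine hE (hε n) (hδ0 (n + 1)) fun x hx y hy hxy =>
      hd n x hx y hy (hxy.trans_le (min_le_left _ _))
  choose M u' hM hu' hclose using href
  obtain ⟨T₀, u₀, h₀⟩ := exists_isDenseWalk hE hne hc (hδ0 0)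
  let w : ∀ n, {p : ℕ × (ℕ → X) // IsDenseWalk E (δ n) p.1 p.2} := fun n =>
    Nat.rec ⟨(T₀, u₀), h₀⟩ (fun n p => ⟨(p.1.1 * M n p, u' n p), hu' n p⟩) n
  have hT0 : ∀ n, 0 < (w n).1.1 := fun n => (w n).2.pos
  -- These step functions are discontinuous, but they converge uniformly and their jumps tend to
  -- zero, so the limit is continuous.
  let g : ℕ → unitInterval → X := fun n t => (w n).1.2 ⌊(t : ℝ) * (w n).1.1⌋₊
  have hfl : ∀ n (t : unitInterval), ⌊(t : ℝ) * (w n).1.1⌋₊ ≤ (w n).1.1 := fun n t => by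
    apply Nat.floor_le_of_le
    have := mul_le_mul_of_nonneg_right t.2.2 (Nat.cast_nonneg (α := ℝ) (w n).1.1)
    simpa using this
  have hgstep : ∀ n t, dist (g n t) (g (n + 1) t) ≤ 1 / 2 ^ n := by
    intro n t
    rw [dist_comm]
    have e : ⌊(t : ℝ) * (w n).1.1⌋₊ = ⌊(t : ℝ) * (w (n + 1)).1.1⌋₊ / M n (w n) := by
      have hM' : (M n (w n) : ℝ) ≠ 0 := by exact_mod_cast (hM n (w n)).ne'
      have : (w (n + 1)).1.1 = (w n).1.1 * M n (w n) := rfl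
      rw [this, ← Nat.floor_div_natCast]
      congr 1
      push_cast
      field_simp
    have := hclose n (w n) _ (hfl (n + 1) t)
    simp only [g]
    rw [e]
    exact this.le
  have hcau : ∀ t, CauchySeq fun n => g n t := fun t =>
    cauchySeq_of_le_geometric (1 / 2) 1 (by norm_num) fun n => by
      have := hgstep n t
      simpa [div_eq_mul_inv] using this
  have hgE : ∀ n t, g n t ∈ E := fun n t => (w n).2.mem _
  choose f hfE hf using fun t => cauchySeq_tendsto_of_isComplete hE.isComplete
    (fun n => hgE n t) (hcau t)
  have hfg : ∀ n t, dist (g n t) (f t) ≤ 2 * (1 / 2 ^ n) := by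
    intro n t
    have := dist_le_of_le_geometric_of_tendsto (1 / 2) 1 (by norm_num)
      (fun n => by simpa [div_eq_mul_inv] using hgstep n t) (hf t) n
    calc dist (g n t) (f t) ≤ _ := this
      _ = 2 * (1 / 2 ^ n) := by rw [one_div_pow]; ring
  have hcont : Continuous f := by
    rw [Metric.continuous_iff]
    intro t ε hε'
    obtain ⟨n, hn⟩ := exists_pow_lt_of_lt_one (show 0 < ε / 5 by positivity)
      (show (1 / 2 : ℝ) < 1 by norm_num)
    rw [one_div_pow] at hn
    have hTr : (0 : ℝ) < (w n).1.1 := by exact_mod_cast hT0 n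
    refine ⟨1 / (w n).1.1, by positivity, fun t' htt' => ?_⟩
    have hgg : ∀ a b : unitInterval, (a : ℝ) ≤ b → (b : ℝ) - a < 1 / (w n).1.1 →
        dist (g n a) (g n b) ≤ 1 / 2 ^ n := by
      intro a b hab hba
      have h1 : ⌊(a : ℝ) * (w n).1.1⌋₊ ≤ ⌊(b : ℝ) * (w n).1.1⌋₊ :=
        Nat.floor_le_floor (mul_le_mul_of_nonneg_right hab hTr.le)
      have h2 : ⌊(b : ℝ) * (w n).1.1⌋₊ ≤ ⌊(a : ℝ) * (w n).1.1⌋₊ + 1 := by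
        rw [← Nat.floor_add_one (mul_nonneg a.2.1 hTr.le)]
        apply Nat.floor_le_floor
        rw [lt_div_iff₀ hTr] at hba
        linarith
      rcases h1.eq_or_lt with h3 | h3
      · simp only [g, h3, dist_self]; exact (hε n).le
      · have h4 : ⌊(b : ℝ) * (w n).1.1⌋₊ = ⌊(a : ℝ) * (w n).1.1⌋₊ + 1 := by omega
        simp only [g, h4]
        refine ((w n).2.step _ ?_).le.trans (hδε n)
        have := hfl n b
        omega
    have hg : dist (g n t') (g n t) ≤ 1 / 2 ^ n := by
      have habs : |(t' : ℝ) - t| < 1 / (w n).1.1 := htt'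
      rw [abs_lt] at habs
      rcases le_total (t' : ℝ) t with h | h
      · exact hgg _ _ h (by linarith)
      · rw [dist_comm]; exact hgg _ _ h (by linarith)
    have h1 := hfg n t
    have h2 := hfg n t'
    have h3 := dist_triangle4 (f t') (g n t') (g n t) (f t)
    rw [dist_comm (f t') (g n t')] at h3
    linarith
  refine ⟨f, hcont, Subset.antisymm (range_subset_iff.mpr hfE) fun z hz => ?_⟩
  -- The range is compact, so it is enough to approximate each point of `E`, which the density of
  -- the walks provides.
  have hclosed : IsClosed (range f) := (isCompact_range hcont).isClosed
  rw [← hclosed.closure_eq, Metric.mem_closure_iff]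
  intro ε hε'
  obtain ⟨n, hn⟩ := exists_pow_lt_of_lt_one (show 0 < ε / 5 by positivity)
    (show (1 / 2 : ℝ) < 1 by norm_num)
  rw [one_div_pow] at hn
  obtain ⟨i, hi, hzi⟩ := (w n).2.dense z hz
  have hTr : (0 : ℝ) < (w n).1.1 := by exact_mod_cast hT0 n
  have hiT : (i : ℝ) ≤ (w n).1.1 := by exact_mod_cast hi.le
  let t : unitInterval := ⟨(i : ℝ) / (w n).1.1, by positivity, (div_le_one hTr).mpr hiT⟩
  have hgt : g n t = (w n).1.2 i := by
    simp only [g, t]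
    rw [div_mul_cancel₀ _ hTr.ne', Nat.floor_natCast]
  refine ⟨f t, mem_range_self t, ?_⟩
  have h1 := hfg n t
  rw [hgt] at h1
  have h2 := dist_triangle z ((w n).1.2 i) (f t)
  have h3 := hδε n
  linarith

end ChainConnected

/-! ### Connectivity in finite grids -/

section Grid

variable {ι : Type*} {n : ℕ}

/-- `q` is the neighbour of the grid point `p` in a positive coordinate direction. -/
def GridSucc (p q : ι → Fin n) : Prop :=
  ∃ i, (q i : ℕ) = p i + 1 ∧ ∀ j, j ≠ i → q j = p j

/-- Connectivity by grid neighbours inside `U`. -/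
def GridConn (U : Set (ι → Fin n)) : (ι → Fin n) → (ι → Fin n) → Prop :=
  Relation.ReflTransGen fun a b => a ∈ U ∧ b ∈ U ∧ (GridSucc a b ∨ GridSucc b a)

theorem GridConn.symm {U : Set (ι → Fin n)} {p q : ι → Fin n} (h : GridConn U p q) :
    GridConn U q p := by
  induction h with
  | refl => exact Relation.ReflTransGen.refl
  | tail _ hab ih => exact ih.head ⟨hab.2.1, hab.1, hab.2.2.symm⟩

theorem GridConn.trans {U : Set (ι → Fin n)} {p q r : ι → Fin n} (h : GridConn U p q)
    (h' : GridConn U q r) : GridConn U p r :=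
  Relation.ReflTransGen.trans h h'

theorem GridConn.mono {U V : Set (ι → Fin n)} (hUV : U ⊆ V) {p q : ι → Fin n}
    (h : GridConn U p q) : GridConn V p q := by
  induction h with
  | refl => exact Relation.ReflTransGen.refl
  | tail _ hab ih => exact ih.tail ⟨hUV hab.1, hUV hab.2.1, hab.2.2⟩

theorem GridConn.succ {U : Set (ι → Fin n)} {p q : ι → Fin n} (hp : p ∈ U) (hq : q ∈ U)
    (h : GridSucc p q) : GridConn U p q :=
  Relation.ReflTransGen.single ⟨hp, hq, Or.inl h⟩

/-- Decreasing a nonzero coordinate by one stays in a lower set; induction on the sum of the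
coordinates. -/
theorem IsLowerSet.gridConn_zero [Fintype ι] [NeZero n] {U : Set (ι → Fin n)}
    (hU : IsLowerSet U) {p : ι → Fin n} (hp : p ∈ U) : GridConn U 0 p := by
  classical
  induction hk : ∑ i, (p i : ℕ) using Nat.strong_induction_on generalizing p with
  | _ k ih =>
    by_cases h0 : p = 0
    · rw [h0]; exact Relation.ReflTransGen.refl
    · obtain ⟨i, hi⟩ := Function.ne_iff.mp h0
      have hi0 : (p i : ℕ) ≠ 0 := fun h => hi (Fin.ext (by simpa using h))
      let p' : ι → Fin n := Function.update p i ⟨p i - 1, by omega⟩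
      have hle : p' ≤ p := by
        intro j
        by_cases hj : j = i
        · subst hj; simp [p', Fin.le_def]
        · simp [p', hj]
      have hp' : p' ∈ U := hU hle hp
      have hsum : ∑ j, (p' j : ℕ) < k := by
        rw [← hk]
        refine Finset.sum_lt_sum (fun j _ => hle j) ⟨i, Finset.mem_univ _, ?_⟩
        simp only [p', Function.update_self]
        omega
      refine (ih _ hsum hp' rfl).trans (GridConn.succ hp' hp ⟨i, ?_, ?_⟩)
      · simp only [p', Function.update_self]; omega
      · intro j hj; simp [p', hj]

theorem IsLowerSet.gridConn [Fintype ι] [NeZero n] {U : Set (ι → Fin n)}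
    (hU : IsLowerSet U) {p q : ι → Fin n} (hp : p ∈ U) (hq : q ∈ U) : GridConn U p q :=
  (hU.gridConn_zero hp).symm.trans (hU.gridConn_zero hq)

end Grid

theorem EuclideanSpace.dist_le_card_mul {ι : Type*} [Fintype ι] {x y : EuclideanSpace ℝ ι} {b : ℝ}
    (hb : 0 ≤ b) (h : ∀ i, |x i - y i| ≤ b) : dist x y ≤ Fintype.card ι * b := by
  rw [EuclideanSpace.dist_eq]
  apply Real.sqrt_le_iff.mpr
  refine ⟨by positivity, ?_⟩
  calc ∑ i, dist (x i) (y i) ^ 2 ≤ ∑ _i : ι, b ^ 2 :=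
        Finset.sum_le_sum fun i _ => pow_le_pow_left₀ dist_nonneg (h i) 2
    _ = Fintype.card ι * b ^ 2 := by simp
    _ ≤ (Fintype.card ι * b) ^ 2 := by
      rw [mul_pow]
      refine mul_le_mul_of_nonneg_right ?_ (sq_nonneg b)
      exact_mod_cast Nat.le_self_pow two_ne_zero _

/-! ### Subdivision of Euclidean cubes -/

section Cubes

variable {m : ℕ}

/-- The axis-parallel cube with lower corner `z` and side length `l`. -/
def cubeAt (z : Fin m → ℝ) (l : ℝ) : Set (EuclideanSpace ℝ (Fin m)) :=
  {x | ∀ i, x i ∈ Icc (z i) (z i + l)}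

/-- For the sup metric `μH[m]` is Lebesgue measure; passing to the Euclidean metric is Lipschitz and
only costs a constant. -/
theorem hausdorffMeasure_cubeAt_le (m : ℕ) :
    ∃ D : ℝ, 0 ≤ D ∧ ∀ (z : Fin m → ℝ) (l : ℝ), 0 ≤ l →
      μH[(m : ℝ)] (cubeAt z l) ≤ ENNReal.ofReal (D * l ^ m) := by
  obtain ⟨K, hK⟩ : ∃ K : ℝ≥0, LipschitzWith K (WithLp.toLp 2 : (Fin m → ℝ) → EuclideanSpace ℝ (Fin m)) :=
    ⟨_, PiLp.lipschitzWith_toLp 2 fun _ : Fin m => ℝ⟩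
  refine ⟨(K : ℝ) ^ m, by positivity, fun z l hl => ?_⟩
  have himg : cubeAt z l = WithLp.toLp 2 '' (Icc z (fun i => z i + l)) := by
    ext x
    constructor
    · intro hx
      exact ⟨WithLp.ofLp x, ⟨fun i => (hx i).1, fun i => (hx i).2⟩, rfl⟩
    · rintro ⟨y, hy, rfl⟩ i
      exact ⟨hy.1 i, hy.2 i⟩
  rw [himg]
  refine (hK.hausdorffMeasure_image_le (Nat.cast_nonneg m) _).trans ?_
  have := hausdorffMeasure_pi_real (ι := Fin m)
  rw [Fintype.card_fin] at this
  rw [this, Real.volume_Icc_pi]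
  simp only [add_sub_cancel_left, Finset.prod_const, Finset.card_univ, Fintype.card_fin,
    ENNReal.rpow_natCast]
  rw [ENNReal.ofReal_mul (by positivity), ENNReal.ofReal_pow hl, ENNReal.ofReal_pow K.coe_nonneg,
    ENNReal.ofReal_coe_nnreal]

/-- The lower corner of the subcube of index `j`, when the cube is cut into `p ^ m` subcubes. -/
noncomputable def subCorner (z : Fin m → ℝ) (l : ℝ) {p : ℕ} (j : Fin m → Fin p) : Fin m → ℝ :=
  fun i => z i + j i * (l / p)

theorem cubeAt_subCorner_subset {z : Fin m → ℝ} {l : ℝ} (hl : 0 ≤ l) {p : ℕ}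
    (j : Fin m → Fin p) : cubeAt (subCorner z l j) (l / p) ⊆ cubeAt z l := by
  intro x hx i
  have h := hx i
  simp only [subCorner, mem_Icc] at h ⊢
  have hp : (0 : ℝ) < p := by exact_mod_cast (Nat.zero_le _).trans_lt (j i).2
  have h1 : ((j i : ℕ) : ℝ) + 1 ≤ p := by exact_mod_cast (j i).2
  have h2 : (((j i : ℕ) : ℝ) + 1) * (l / p) ≤ p * (l / p) :=
    mul_le_mul_of_nonneg_right h1 (by positivity)
  rw [mul_div_cancel₀ _ hp.ne'] at h2
  have h3 : 0 ≤ ((j i : ℕ) : ℝ) * (l / p) := by positivity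
  constructor <;> linarith

theorem exists_mem_cubeAt_subCorner {z : Fin m → ℝ} {l : ℝ} (hl : 0 < l) {p : ℕ} (hp : 0 < p)
    {x : EuclideanSpace ℝ (Fin m)} (hx : x ∈ cubeAt z l) :
    ∃ j : Fin m → Fin p, x ∈ cubeAt (subCorner z l j) (l / p) := by
  have hp' : (0 : ℝ) < p := by exact_mod_cast hp
  have hlp : 0 < l / p := by positivity
  have key : ∀ i, ∃ j : Fin p, x i ∈ Icc (z i + j * (l / p)) (z i + j * (l / p) + l / p) := by
    intro i
    have h := hx i
    set t := (x i - z i) / (l / p) with ht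
    have ht0 : 0 ≤ t := div_nonneg (by linarith [h.1]) hlp.le
    have htx : t * (l / p) = x i - z i := div_mul_cancel₀ _ hlp.ne'
    have htp : t ≤ p := by
      rw [ht, div_le_iff₀ hlp, mul_div_cancel₀ _ hp'.ne']; linarith [h.2]
    rcases lt_or_ge ⌊t⌋₊ p with hlt | hge
    · refine ⟨⟨⌊t⌋₊, hlt⟩, ?_, ?_⟩
      · have := mul_le_mul_of_nonneg_right (Nat.floor_le ht0) hlp.le
        simp only
        linarith
      · have := mul_le_mul_of_nonneg_right (Nat.lt_floor_add_one t).le hlp.le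
        simp only
        linarith
    -- The far face of the cube is assigned to the last subcube.
    · have htp' : t = p := le_antisymm htp ((Nat.cast_le.mpr hge).trans (Nat.floor_le ht0))
      refine ⟨⟨p - 1, by omega⟩, ?_, ?_⟩
      all_goals
        simp only [Nat.cast_sub hp, Nat.cast_one]
        rw [htp'] at htx
        linarith
  choose j hj using key
  exact ⟨j, fun i => hj i⟩

theorem dist_le_of_mem_cubeAt {z : Fin m → ℝ} {l : ℝ} (hl : 0 ≤ l)
    {x y : EuclideanSpace ℝ (Fin m)} (hx : x ∈ cubeAt z l) (hy : y ∈ cubeAt z l) :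
    dist x y ≤ m * l := by
  have := EuclideanSpace.dist_le_card_mul (x := x) (y := y) hl fun i => by
    have h1 := hx i
    have h2 := hy i
    rw [abs_le]
    constructor <;> linarith [h1.1, h1.2, h2.1, h2.2]
  simpa using this

theorem dist_le_of_gridSucc {z : Fin m → ℝ} {l : ℝ} (hl : 0 ≤ l) {p : ℕ} {j j' : Fin m → Fin p}
    (hj : GridSucc j j') {x y : EuclideanSpace ℝ (Fin m)} (hx : x ∈ cubeAt (subCorner z l j) (l / p))
    (hy : y ∈ cubeAt (subCorner z l j') (l / p)) : dist x y ≤ 2 * m * (l / p) := by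
  have hlp : 0 ≤ l / p := by positivity
  have := EuclideanSpace.dist_le_card_mul (x := x) (y := y) (b := 2 * (l / p)) (by positivity)
    fun i => by
      have h1 := hx i
      have h2 := hy i
      obtain ⟨i₀, h3, h4⟩ := hj
      simp only [subCorner, mem_Icc] at h1 h2
      rw [abs_le]
      by_cases hi : i = i₀
      · subst hi
        rw [h3] at h2
        push_cast at h2
        constructor <;> linarith [h1.1, h1.2, h2.1, h2.2]
      · rw [h4 i hi] at h2
        constructor <;> linarith [h1.1, h1.2, h2.1, h2.2]
  simpa [mul_assoc, mul_left_comm] using this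

end Cubes

/-! ### Hölder images of cubes meet finely separated sets in null sets -/

section Holder

variable {X : Type*} [MetricSpace X] [MeasurableSpace X] [BorelSpace X]

/-- If a subcube of every cube either meets `T` in all its subcubes, in which case the image is
small, or loses one of them, then the image of `T` is small. -/
theorem hausdorffMeasure_image_cubeAt_le {m p : ℕ} {s Ψ D : ℝ} (hp : 0 < p) (hΨ : 0 ≤ Ψ)
    (hD : 0 ≤ D) {f : EuclideanSpace ℝ (Fin m) → X} {T : Set (EuclideanSpace ℝ (Fin m))}
    (hgood : ∀ z l, 0 < l → l ≤ 1 →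
      (∀ j : Fin m → Fin p, (T ∩ cubeAt (subCorner z l j) (l / p)).Nonempty) →
      μH[s] (f '' (T ∩ cubeAt z l)) ≤ ENNReal.ofReal (Ψ * l ^ m))
    (hall : ∀ z l, 0 < l → l ≤ 1 →
      μH[s] (f '' (T ∩ cubeAt z l)) ≤ ENNReal.ofReal (D * l ^ m))
    (q : ℕ) (z : Fin m → ℝ) (l : ℝ) (hl : 0 < l) (hl1 : l ≤ 1) :
    μH[s] (f '' (T ∩ cubeAt z l)) ≤
      ENNReal.ofReal ((Ψ + D * (1 - 1 / (p : ℝ) ^ m) ^ q) * l ^ m) := by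
  classical
  have hp1 : (1 : ℝ) ≤ (p : ℝ) ^ m := one_le_pow₀ (by exact_mod_cast hp)
  have hp0 : (0 : ℝ) < p := by exact_mod_cast hp
  have hθ : (0 : ℝ) ≤ 1 - 1 / (p : ℝ) ^ m := by
    rw [sub_nonneg, div_le_one (by positivity)]; exact hp1
  induction q generalizing z l with
  | zero =>
    refine (hall z l hl hl1).trans (ENNReal.ofReal_le_ofReal ?_)
    refine mul_le_mul_of_nonneg_right ?_ (by positivity)
    simpa using hΨ
  | succ q ih =>
    by_cases hg : ∀ j : Fin m → Fin p, (T ∩ cubeAt (subCorner z l j) (l / p)).Nonempty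
    · refine (hgood z l hl hl1 hg).trans (ENNReal.ofReal_le_ofReal ?_)
      refine mul_le_mul_of_nonneg_right ?_ (by positivity)
      have : 0 ≤ D * (1 - 1 / (p : ℝ) ^ m) ^ (q + 1) := by positivity
      linarith
    · push Not at hg
      obtain ⟨j₀, hj₀⟩ := hg
      -- The subcube `j₀` contributes nothing. The other `p ^ m - 1`, each of side `l / p`, give the
      -- factor `1 - 1 / p ^ m` by induction.
      have hsub : f '' (T ∩ cubeAt z l) ⊆ ⋃ j ∈ Finset.univ.erase j₀,
          f '' (T ∩ cubeAt (subCorner z l j) (l / p)) := by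
        rintro _ ⟨x, ⟨hxT, hx⟩, rfl⟩
        obtain ⟨j, hj⟩ := exists_mem_cubeAt_subCorner hl hp hx
        refine mem_iUnion₂.mpr ⟨j, ?_, x, ⟨hxT, hj⟩, rfl⟩
        refine Finset.mem_erase.mpr ⟨?_, Finset.mem_univ _⟩
        rintro rfl
        exact (hj₀ ▸ (⟨hxT, hj⟩ : x ∈ T ∩ _) : x ∈ (∅ : Set _))
      have hlp1 : l / p ≤ 1 := (div_le_self hl.le (by exact_mod_cast hp)).trans hl1
      set B : ℝ := (Ψ + D * (1 - 1 / (p : ℝ) ^ m) ^ q) * (l / p) ^ m with hB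
      have hB0 : 0 ≤ B := by positivity
      have hcard : (Finset.univ.erase j₀).card = p ^ m - 1 := by
        rw [Finset.card_erase_of_mem (Finset.mem_univ _)]; simp
      calc μH[s] (f '' (T ∩ cubeAt z l))
          ≤ ∑ j ∈ Finset.univ.erase j₀, μH[s] (f '' (T ∩ cubeAt (subCorner z l j) (l / p))) :=
            (measure_mono hsub).trans (measure_biUnion_finset_le _ _)
        _ ≤ ∑ _j ∈ Finset.univ.erase j₀, ENNReal.ofReal B :=
            Finset.sum_le_sum fun j _ => ih _ _ (by positivity) hlp1
        _ = ENNReal.ofReal ((p ^ m - 1 : ℕ) * B) := by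
            rw [Finset.sum_const, hcard, nsmul_eq_mul, ENNReal.ofReal_mul (Nat.cast_nonneg _),
              ENNReal.ofReal_natCast]
        _ ≤ _ := by
            apply ENNReal.ofReal_le_ofReal
            rw [Nat.cast_sub (Nat.one_le_pow _ _ hp), hB, div_pow]
            push_cast
            have e : ((p : ℝ) ^ m - 1) * ((Ψ + D * (1 - 1 / (p : ℝ) ^ m) ^ q) * (l ^ m / (p : ℝ) ^ m))
                = (1 - 1 / (p : ℝ) ^ m) * (Ψ + D * (1 - 1 / (p : ℝ) ^ m) ^ q) * l ^ m := by
              field_simp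
            rw [e]
            refine mul_le_mul_of_nonneg_right ?_ (by positivity)
            have h1 : (1 - 1 / (p : ℝ) ^ m) * Ψ ≤ Ψ := by
              have : 0 ≤ 1 / (p : ℝ) ^ m * Ψ := by positivity
              linarith
            rw [pow_succ]
            linarith

/-- A set whose finely chained subsets are small meets every `(m / s)`-Hölder image of the unit
cube in a null set. -/
theorem hausdorffMeasure_inter_holderImage_eq_zero {m : ℕ} (hm : 1 ≤ m) {s : ℝ} (hs : 1 < s)
    {K : Set X} {C : ℝ} (hC : 0 ≤ C)
    (hK : ∀ A ⊆ K, ∀ ρ δ : ℝ, 0 < δ → δ ≤ ρ → δ ≤ 1 → (∀ x ∈ A, ∀ y ∈ A, dist x y ≤ ρ) →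
      (∀ x ∈ A, ∀ y ∈ A, ChainIn A δ x y) → μH[s] A ≤ ENNReal.ofReal (C * ρ * δ ^ (s - 1)))
    {f : EuclideanSpace ℝ (Fin m) → X} {H : ℝ≥0}
    (hf : HolderOnWith H ((m : ℝ) / s).toNNReal f (unitCube m)) :
    μH[s] (K ∩ f '' unitCube m) = 0 := by
  have hs0 : 0 < s := one_pos.trans hs
  have hm0 : (0 : ℝ) < m := by exact_mod_cast hm
  set α : ℝ := (m : ℝ) / s with hα
  have hα0 : 0 < α := by positivity
  have hαs : α * s = m := div_mul_cancel₀ _ hs0.ne'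
  have hαc : ((α.toNNReal : ℝ≥0) : ℝ) = α := Real.coe_toNNReal _ hα0.le
  -- Chains need strict inequalities: `H + 1` instead of `H` provides them, except when `b = 0`,
  -- where the images coincide.
  have hdist : ∀ x ∈ unitCube m, ∀ y ∈ unitCube m, ∀ b, dist x y ≤ b →
      dist (f x) (f y) < (H + 1) * b ^ α ∨ dist (f x) (f y) = 0 := by
    intro x hx y hy b hb
    have h1 := hf.dist_le_of_le hx hy hb
    rw [hαc] at h1
    rcases (dist_nonneg.trans hb).eq_or_lt with h0 | h0
    · right
      rw [← h0, Real.zero_rpow hα0.ne', mul_zero] at h1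
      exact le_antisymm h1 dist_nonneg
    · left
      refine h1.trans_lt (mul_lt_mul_of_pos_right (by linarith) (Real.rpow_pos_of_pos h0 _))
  set T := unitCube m ∩ f ⁻¹' K with hT
  have hTK : f '' T = K ∩ f '' unitCube m := by
    ext x; constructor
    · rintro ⟨t, ⟨h1, h2⟩, rfl⟩; exact ⟨h2, t, h1, rfl⟩
    · rintro ⟨h2, t, h1, rfl⟩; exact ⟨t, ⟨h1, h2⟩, rfl⟩
  obtain ⟨D₀, hD₀, hcube⟩ := hausdorffMeasure_cubeAt_le m
  have hall : ∀ z l, 0 < l → l ≤ 1 →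
      μH[s] (f '' (T ∩ cubeAt z l)) ≤ ENNReal.ofReal ((H : ℝ) ^ s * D₀ * l ^ m) := by
    intro z l hl _
    have h1 := (hf.mono (inter_subset_left.trans inter_subset_left :
      T ∩ cubeAt z l ⊆ unitCube m)).hausdorffMeasure_image_le (by simpa using hα0) hs0.le
    rw [hαc, hαs] at h1
    refine h1.trans ?_
    rw [mul_assoc, ENNReal.ofReal_mul (by positivity),
      ← ENNReal.ofReal_rpow_of_nonneg H.coe_nonneg hs0.le, ENNReal.ofReal_coe_nnreal]
    gcongr
    exact (measure_mono inter_subset_right).trans (hcube z l hl.le)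
  set D := (H : ℝ) ^ s * D₀ with hD
  have hD0 : 0 ≤ D := by positivity
  -- Points of adjacent subcubes of side `l / p` are at distance at most `2 * m * (l / p)`, so `c₁ *
  -- (l / p) ^ α` bounds the steps of the image chain and `c₁ * l ^ α` its diameter.
  set c₁ : ℝ := (H + 1) * (2 * m) ^ α with hc₁
  have hc₁0 : 0 < c₁ := by positivity
  -- One point of `T` chosen in each subcube links all of `f '' (T ∩ cubeAt z l)`. The bound `C * ρ
  -- * δ ^ (s - 1)` is then of order `l ^ m`, because `α * s = m`, with the gain `((1 / p) ^ α) ^ (s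
  -- - 1)`.
  have hgood : ∀ p : ℕ, 0 < p → c₁ * (1 / (p : ℝ)) ^ α ≤ 1 → ∀ z l, 0 < l → l ≤ 1 →
      (∀ j : Fin m → Fin p, (T ∩ cubeAt (subCorner z l j) (l / p)).Nonempty) →
      μH[s] (f '' (T ∩ cubeAt z l)) ≤
        ENNReal.ofReal (C * c₁ ^ s * ((1 / (p : ℝ)) ^ α) ^ (s - 1) * l ^ m) := by
    intro p hp hpc z l hl hl1 hne
    have : NeZero p := ⟨hp.ne'⟩
    have hp0 : (0 : ℝ) < p := by exact_mod_cast hp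
    set A := f '' (T ∩ cubeAt z l) with hA
    set δ := c₁ * (1 / (p : ℝ)) ^ α * l ^ α with hδ
    set ρ := c₁ * l ^ α with hρ
    have hδ0 : 0 < δ := by positivity
    have hlα : l ^ α ≤ 1 := Real.rpow_le_one hl.le hl1 hα0.le
    have hpα : (1 / (p : ℝ)) ^ α ≤ 1 := Real.rpow_le_one (by positivity)
      (by rw [div_le_one hp0]; exact_mod_cast hp) hα0.le
    have hδρ : δ ≤ ρ := by
      rw [hδ, hρ]
      refine mul_le_mul_of_nonneg_right ?_ (by positivity)
      exact mul_le_of_le_one_right hc₁0.le hpα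
    have hδ1 : δ ≤ 1 := by
      rw [hδ]
      exact mul_le_one₀ hpc (by positivity) hlα
    have hδval : (H + 1) * (2 * m * (l / p)) ^ α = δ := by
      rw [hδ, hc₁, Real.mul_rpow (by positivity) (by positivity), div_eq_mul_one_div,
        Real.mul_rpow hl.le (by positivity)]
      ring
    have hstep : ∀ x ∈ T ∩ cubeAt z l, ∀ y ∈ T ∩ cubeAt z l, dist x y ≤ 2 * m * (l / p) →
        ChainIn A δ (f x) (f y) := by
      intro x hx y hy hxy
      refine ChainIn.step ⟨x, hx, rfl⟩ ⟨y, hy, rfl⟩ ?_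
      rcases hdist x hx.1.1 y hy.1.1 _ hxy with h | h
      · rwa [hδval] at h
      · rwa [h]
    choose t ht using hne
    have htQ : ∀ j, t j ∈ T ∩ cubeAt z l := fun j =>
      ⟨(ht j).1, cubeAt_subCorner_subset hl.le j (ht j).2⟩
    have htt : ∀ j j', ChainIn A δ (f (t j)) (f (t j')) := by
      intro j j'
      have hc : GridConn univ j j' := isLowerSet_univ.gridConn (mem_univ _) (mem_univ _)
      induction hc with
      | refl => exact Relation.ReflTransGen.refl
      | tail _ hab ih =>
        refine ih.trans ?_
        rcases hab.2.2 with h | h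
        · exact hstep _ (htQ _) _ (htQ _) (dist_le_of_gridSucc hl.le h (ht _).2 (ht _).2)
        · exact (hstep _ (htQ _) _ (htQ _) (dist_le_of_gridSucc hl.le h (ht _).2 (ht _).2)).symm
    have hxt : ∀ x ∈ T ∩ cubeAt z l, ∃ j, ChainIn A δ (f x) (f (t j)) := by
      intro x hx
      obtain ⟨j, hj⟩ := exists_mem_cubeAt_subCorner hl hp hx.2
      refine ⟨j, hstep _ hx _ (htQ j) ?_⟩
      have h1 := dist_le_of_mem_cubeAt (by positivity) hj (ht j).2
      have : 0 ≤ (m : ℝ) * (l / p) := by positivity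
      linarith
    have hAK : A ⊆ K := by
      rintro _ ⟨x, hx, rfl⟩; exact hx.1.2
    have hmain := hK A hAK ρ δ hδ0 hδρ hδ1 ?_ ?_
    · refine hmain.trans_eq ?_
      congr 1
      have e1 : c₁ ^ s = c₁ * c₁ ^ (s - 1) := by
        rw [← Real.rpow_one_add' hc₁0.le (by linarith)]; congr 1; ring
      have e2 : l ^ m = l ^ α * (l ^ α) ^ (s - 1) := by
        rw [← Real.rpow_one_add' (by positivity) (by linarith), ← Real.rpow_mul hl.le]
        have : α * (1 + (s - 1)) = m := by rw [← hαs]; ring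
        rw [this, Real.rpow_natCast]
      rw [e1, e2, hρ, hδ, Real.mul_rpow (by positivity) (by positivity),
        Real.mul_rpow (by positivity) (by positivity)]
      ring
    · rintro _ ⟨x, hx, rfl⟩ _ ⟨y, hy, rfl⟩
      have h1 := dist_le_of_mem_cubeAt hl.le hx.2 hy.2
      have h2 : dist x y ≤ 2 * m * l := by
        have : 0 ≤ (m : ℝ) * l := by positivity
        linarith
      have e : (H + 1) * (2 * m * l) ^ α = ρ := by
        rw [hρ, hc₁, Real.mul_rpow (by positivity) hl.le]; ring
      rcases hdist x hx.1.1 y hy.1.1 _ h2 with h | h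
      · rw [e] at h; exact h.le
      · rw [h]; positivity
    · rintro _ ⟨x, hx, rfl⟩ _ ⟨y, hy, rfl⟩
      obtain ⟨j, hj⟩ := hxt x hx
      obtain ⟨j', hj'⟩ := hxt y hy
      exact hj.trans ((htt j j').trans hj'.symm)
  have hTcube : T ∩ cubeAt (0 : Fin m → ℝ) 1 = T := by
    refine inter_eq_left.mpr fun x hx i => ?_
    have := hx.1 i
    simpa using this
  have hp_lim : Filter.Tendsto (fun p : ℕ => (1 / (p : ℝ)) ^ α) Filter.atTop (nhds 0) := by
    have h1 : Filter.Tendsto (fun p : ℕ => (1 / (p : ℝ))) Filter.atTop (nhds 0) :=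
      tendsto_one_div_atTop_nhds_zero_nat
    have := h1.rpow_const (p := α) (Or.inr hα0.le)
    rwa [Real.zero_rpow hα0.ne'] at this
  have hev : ∀ᶠ p : ℕ in Filter.atTop, c₁ * (1 / (p : ℝ)) ^ α ≤ 1 := by
    have := hp_lim.const_mul c₁
    rw [mul_zero] at this
    exact this.eventually_le_const one_pos
  -- First `q → ∞` with `p` fixed, which removes the term with `D`; then `p → ∞`, which uses `s >
  -- 1`.
  have hbound : ∀ᶠ p : ℕ in Filter.atTop, μH[s] (f '' T) ≤
      ENNReal.ofReal (C * c₁ ^ s * ((1 / (p : ℝ)) ^ α) ^ (s - 1)) := by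
    filter_upwards [hev, Filter.eventually_gt_atTop 0] with p hpc hp
    have hΨ : 0 ≤ C * c₁ ^ s * ((1 / (p : ℝ)) ^ α) ^ (s - 1) := by positivity
    have hq := fun q => hausdorffMeasure_image_cubeAt_le hp hΨ hD0 (hgood p hp hpc) hall q 0 1
      one_pos le_rfl
    simp only [hTcube, one_pow, mul_one] at hq
    have hp1 : (1 : ℝ) ≤ (p : ℝ) ^ m := one_le_pow₀ (by exact_mod_cast hp)
    have hpp : (0 : ℝ) < 1 / (p : ℝ) ^ m := by positivity
    have hlim : Filter.Tendsto (fun q : ℕ => ENNReal.ofReal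
        (C * c₁ ^ s * ((1 / (p : ℝ)) ^ α) ^ (s - 1) + D * (1 - 1 / (p : ℝ) ^ m) ^ q)) Filter.atTop
        (nhds (ENNReal.ofReal (C * c₁ ^ s * ((1 / (p : ℝ)) ^ α) ^ (s - 1) + D * 0))) := by
      refine ENNReal.tendsto_ofReal ((Filter.Tendsto.const_mul D ?_).const_add _)
      refine tendsto_pow_atTop_nhds_zero_of_lt_one ?_ (by linarith)
      rw [sub_nonneg, div_le_one (by positivity)]; exact hp1
    rw [mul_zero, add_zero] at hlim
    exact ge_of_tendsto' hlim hq
  have hlim : Filter.Tendsto (fun p : ℕ => ENNReal.ofReal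
      (C * c₁ ^ s * ((1 / (p : ℝ)) ^ α) ^ (s - 1))) Filter.atTop (nhds 0) := by
    have h1 := hp_lim.rpow_const (p := s - 1) (Or.inr (by linarith))
    rw [Real.zero_rpow (by linarith)] at h1
    have h2 := ENNReal.tendsto_ofReal (h1.const_mul (C * c₁ ^ s))
    rwa [mul_zero, ENNReal.ofReal_zero] at h2
  rw [← hTK]
  exact le_antisymm (ge_of_tendsto hlim hbound) zero_le

end Holder

/-! ### From a measure with power growth to Ahlfors regularity -/

section Frostman

variable {X : Type*} [MetricSpace X] [MeasurableSpace X] [BorelSpace X]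

/-- The mass distribution principle. -/
theorem le_mul_hausdorffMeasure {ν : Measure X} {s C : ℝ} (hs : 0 < s) (hC : 0 < C)
    (hup : ∀ x r, 0 < r → ν (Metric.closedBall x r) ≤ ENNReal.ofReal (C * r ^ s)) (A : Set X) :
    ν A ≤ ENNReal.ofReal C * μH[s] A := by
  have hC0 : ENNReal.ofReal C ≠ 0 := by simpa using hC
  have hle : (ENNReal.ofReal C)⁻¹ • ν ≤ μH[s] := by
    refine Measure.le_hausdorffMeasure s _ 1 one_pos fun U hU => ?_
    rcases U.eq_empty_or_nonempty with rfl | ⟨x, hx⟩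
    · simp
    have hfin : Metric.ediam U ≠ ∞ := ne_top_of_le_ne_top ENNReal.one_ne_top hU
    have hsub : ∀ r, Metric.diam U ≤ r → U ⊆ Metric.closedBall x r := fun r hr y hy =>
      Metric.mem_closedBall.mpr ((Metric.dist_le_diam_of_mem' hfin hy hx).trans hr)
    rw [Measure.smul_apply, smul_eq_mul, ENNReal.inv_mul_le_iff hC0 ENNReal.ofReal_ne_top]
    have hd : Metric.ediam U = ENNReal.ofReal (Metric.diam U) := (ENNReal.ofReal_toReal hfin).symm
    rw [hd, ENNReal.ofReal_rpow_of_nonneg Metric.diam_nonneg hs.le, ← ENNReal.ofReal_mul hC.le]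
    -- The growth bound requires a positive radius, while `U` may have diameter zero; the radius is
    -- enlarged slightly and the limit taken.
    have hlim : Filter.Tendsto (fun n : ℕ => ENNReal.ofReal
        (C * (Metric.diam U + 1 / ((n : ℝ) + 1)) ^ s)) Filter.atTop
        (nhds (ENNReal.ofReal (C * (Metric.diam U + 0) ^ s))) := by
      refine ENNReal.tendsto_ofReal (Filter.Tendsto.const_mul C ?_)
      exact (tendsto_one_div_add_atTop_nhds_zero_nat.const_add _).rpow_const (Or.inr hs.le)
    rw [add_zero] at hlim
    refine ge_of_tendsto' hlim fun n => ?_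
    have hn : (0 : ℝ) < 1 / ((n : ℝ) + 1) := by positivity
    exact (measure_mono (hsub _ (by linarith))).trans
      (hup _ _ (by linarith [Metric.diam_nonneg (s := U)]))
  have h := hle A
  rwa [Measure.smul_apply, smul_eq_mul,
    ENNReal.inv_mul_le_iff hC0 ENNReal.ofReal_ne_top] at h

/-- Take a maximal `δ`-separated subset of the intersection. Its balls of radius `δ / 2` are
disjoint in a ball of radius `2 * r`, which bounds their number; its balls of radius `δ` cover.
Letting `δ → 0` gives the bound. The constant is `8 ^ s = 4 ^ s * 2 ^ s`, from `2 * δ = 4 * (δ / 2)`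
and from the radius `2 * r`. -/
theorem hausdorffMeasure_inter_closedBall_le {ν : Measure X} {E : Set X} {s c C R : ℝ} (hs : 0 < s)
    (hc : 0 < c) (hC : 0 < C) (hR : 0 < R)
    (hup : ∀ x r, 0 < r → ν (Metric.closedBall x r) ≤ ENNReal.ofReal (C * r ^ s))
    (hlow : ∀ x ∈ E, ∀ r, 0 < r → r ≤ R → ENNReal.ofReal (c * r ^ s) ≤ ν (Metric.ball x r))
    (x : X) (r : ℝ) (hr : 0 < r) :
    μH[s] (E ∩ Metric.closedBall x r) ≤ ENNReal.ofReal (C / c * 8 ^ s * r ^ s) := by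
  classical
  set S := E ∩ Metric.closedBall x r with hS
  have hcard : ∀ δ, 0 < δ → δ ≤ R → δ ≤ r → ∀ t : Finset X, (∀ y ∈ t, y ∈ S) →
      (∀ y ∈ t, ∀ z ∈ t, y ≠ z → δ ≤ dist y z) →
      (t.card : ℝ) * (c * (δ / 2) ^ s) ≤ C * (2 * r) ^ s := by
    intro δ hδ hδR hδr t htS hts
    have hsub : ⋃ y ∈ t, Metric.ball y (δ / 2) ⊆ Metric.closedBall x (2 * r) := by
      refine iUnion₂_subset fun y hy => ?_
      have h1 : dist y x ≤ r := (htS y hy).2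
      exact Metric.ball_subset_closedBall.trans
        (Metric.closedBall_subset_closedBall' (by linarith))
    have h1 := (measure_mono hsub).trans (hup x (2 * r) (by positivity))
    rw [measure_biUnion_finset ?_ fun y _ => measurableSet_ball] at h1
    · have h2 : ∑ y ∈ t, ENNReal.ofReal (c * (δ / 2) ^ s) ≤ ENNReal.ofReal (C * (2 * r) ^ s) :=
        (Finset.sum_le_sum fun y hy =>
          hlow y (htS y hy).1 (δ / 2) (by positivity) (by linarith)).trans h1
      rw [Finset.sum_const, nsmul_eq_mul, ← ENNReal.ofReal_natCast,
        ← ENNReal.ofReal_mul (Nat.cast_nonneg _)] at h2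
      exact (ENNReal.ofReal_le_ofReal_iff (by positivity)).mp h2
    · intro y hy z hz hyz
      refine Metric.ball_disjoint_ball ?_
      have := hts y hy z hz hyz
      linarith
  have hnet : ∀ δ, 0 < δ → δ ≤ R → δ ≤ r → ∃ t : Finset X,
      (t.card : ℝ) * (c * (δ / 2) ^ s) ≤ C * (2 * r) ^ s ∧
      S ⊆ ⋃ y ∈ t, Metric.closedBall y δ := by
    intro δ hδ hδR hδr
    let N : Set ℕ := {n | ∃ t : Finset X, t.card = n ∧ (∀ y ∈ t, y ∈ S) ∧
      ∀ y ∈ t, ∀ z ∈ t, y ≠ z → δ ≤ dist y z}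
    have hpos : 0 < c * (δ / 2) ^ s := by positivity
    have hbdd : BddAbove N := by
      refine ⟨⌊C * (2 * r) ^ s / (c * (δ / 2) ^ s)⌋₊, ?_⟩
      rintro n ⟨t, rfl, h1, h2⟩
      apply Nat.le_floor
      rw [le_div_iff₀ hpos]
      exact hcard δ hδ hδR hδr t h1 h2
    obtain ⟨t, ht1, ht2, ht3⟩ := Nat.sSup_mem (s := N) ⟨0, ∅, by simp⟩ hbdd
    refine ⟨t, hcard δ hδ hδR hδr t ht2 ht3, fun y hy => ?_⟩
    by_contra hcon
    simp only [mem_iUnion, Metric.mem_closedBall, not_exists, not_le] at hcon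
    have hyt : y ∉ t := fun h => by
      have := hcon y h
      rw [dist_self] at this
      linarith
    have hmem : t.card + 1 ∈ N := by
      refine ⟨insert y t, Finset.card_insert_of_notMem hyt, ?_, ?_⟩
      · intro z hz
        rcases Finset.mem_insert.mp hz with rfl | hz
        exacts [hy, ht2 z hz]
      · intro z hz w hw hzw
        rcases Finset.mem_insert.mp hz with rfl | hz' <;>
          rcases Finset.mem_insert.mp hw with rfl | hw'
        · exact absurd rfl hzw
        · exact (hcon w hw').le
        · rw [dist_comm]; exact (hcon z hz').le
        · exact ht3 z hz' w hw' hzw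
    have := le_csSup hbdd hmem
    omega
  let δ : ℕ → ℝ := fun n => min R r / ((n : ℝ) + 1)
  have hδ0 : ∀ n, 0 < δ n := fun n => div_pos (lt_min hR hr) (by positivity)
  have hδle : ∀ n, δ n ≤ min R r := fun n => div_le_self (lt_min hR hr).le (by
    have : (0 : ℝ) ≤ n := Nat.cast_nonneg n
    linarith)
  choose t ht1 ht2 using fun n => hnet (δ n) (hδ0 n) ((hδle n).trans (min_le_left _ _))
    ((hδle n).trans (min_le_right _ _))
  have hlim : Filter.Tendsto (fun n => ENNReal.ofReal (2 * δ n)) Filter.atTop (nhds 0) := by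
    have h1 : Filter.Tendsto δ Filter.atTop (nhds 0) := by
      have := (tendsto_one_div_add_atTop_nhds_zero_nat (𝕜 := ℝ)).const_mul (min R r)
      simpa [δ, div_eq_mul_inv] using this
    have := ENNReal.tendsto_ofReal (h1.const_mul 2)
    simpa using this
  have hdiam : ∀ n (y : X), Metric.ediam (Metric.closedBall y (δ n)) ≤ ENNReal.ofReal (2 * δ n) := by
    intro n y
    rw [ENNReal.ofReal_mul (by norm_num), ← Metric.closedEBall_ofReal (hδ0 n).le]
    simpa using Metric.ediam_closedEBall_le (x := y) (r := ENNReal.ofReal (δ n))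
  have hmain := Measure.hausdorffMeasure_le_liminf_sum s S (fun n => ENNReal.ofReal (2 * δ n)) hlim
    (fun n (i : t n) => Metric.closedBall (i : X) (δ n))
    (Filter.Eventually.of_forall fun n i => hdiam n i)
    (Filter.Eventually.of_forall fun n => (ht2 n).trans (by simp [iUnion_subtype]))
  refine hmain.trans ?_
  refine Filter.liminf_le_of_frequently_le' (Filter.Frequently.of_forall fun n => ?_)
  calc ∑ i : t n, Metric.ediam (Metric.closedBall (i : X) (δ n)) ^ s
      ≤ ∑ _i : t n, ENNReal.ofReal ((2 * δ n) ^ s) := by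
        refine Finset.sum_le_sum fun i _ => ?_
        rw [← ENNReal.ofReal_rpow_of_nonneg (by linarith [hδ0 n]) hs.le]
        exact ENNReal.rpow_le_rpow (hdiam n i) hs.le
    _ = ENNReal.ofReal ((t n).card * (2 * δ n) ^ s) := by
        rw [Finset.sum_const, Finset.card_univ, Fintype.card_coe, nsmul_eq_mul,
          ENNReal.ofReal_mul (Nat.cast_nonneg _), ENNReal.ofReal_natCast]
    _ ≤ _ := by
        apply ENNReal.ofReal_le_ofReal
        have h1 := ht1 n
        have hd := hδ0 n
        have e1 : (2 * δ n) ^ s = 4 ^ s * (δ n / 2) ^ s := by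
          rw [← Real.mul_rpow (by norm_num) (by positivity)]; congr 1; ring
        have e2 : (8 : ℝ) ^ s = 4 ^ s * 2 ^ s := by
          rw [← Real.mul_rpow (by norm_num) (by norm_num)]; norm_num
        rw [Real.mul_rpow (by norm_num) hr.le] at h1
        rw [e1, e2]
        have h4 : (0 : ℝ) < 4 ^ s := by positivity
        have h5 : (t n).card * (δ n / 2) ^ s ≤ C / c * (2 ^ s * r ^ s) := by
          rw [div_mul_eq_mul_div, le_div_iff₀ hc]
          linarith
        calc (t n).card * (4 ^ s * (δ n / 2) ^ s) = 4 ^ s * ((t n).card * (δ n / 2) ^ s) := by ring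
          _ ≤ 4 ^ s * (C / c * (2 ^ s * r ^ s)) := mul_le_mul_of_nonneg_left h5 h4.le
          _ = _ := by ring

theorem isAhlforsRegular_of_measure {ν : Measure X} {E : Set X} {s c C R : ℝ} (hs : 0 < s)
    (hc : 0 < c) (hC : 0 < C) (hR : 0 < R)
    (hup : ∀ x r, 0 < r → ν (Metric.closedBall x r) ≤ ENNReal.ofReal (C * r ^ s))
    (hlow : ∀ x ∈ E, ∀ r, 0 < r → r ≤ R → ENNReal.ofReal (c * r ^ s) ≤ ν (Metric.ball x r))
    (hν : ν Eᶜ = 0) (hdiam : Metric.ediam E ≤ ENNReal.ofReal R) : IsAhlforsRegular s E := by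
  refine ⟨c / C, max (c / C) (C / c * 8 ^ s), by positivity, le_max_left _ _,
    fun x hx r hr hrE => ⟨?_, ?_⟩⟩
  · have hrR : r ≤ R := (ENNReal.ofReal_le_ofReal_iff hR.le).mp (hrE.trans hdiam)
    have h1 := hlow x hx r hr hrR
    have h2 : ν (Metric.ball x r) ≤ ν (E ∩ Metric.ball x r) := by
      have : Metric.ball x r ⊆ (E ∩ Metric.ball x r) ∪ Eᶜ := fun y hy => by
        by_cases hyE : y ∈ E
        exacts [Or.inl ⟨hyE, hy⟩, Or.inr hyE]
      refine (measure_mono this).trans ((measure_union_le _ _).trans ?_)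
      rw [hν, add_zero]
    have h3 := h1.trans (h2.trans (le_mul_hausdorffMeasure hs hC hup _))
    rw [div_mul_eq_mul_div, ENNReal.ofReal_div_of_pos hC]
    exact ENNReal.div_le_of_le_mul' h3
  · refine (measure_mono (inter_subset_inter_right _ Metric.ball_subset_closedBall)).trans ?_
    refine (hausdorffMeasure_inter_closedBall_le hs hc hC hR hup hlow x r hr).trans ?_
    apply ENNReal.ofReal_le_ofReal
    exact mul_le_mul_of_nonneg_right (le_max_right _ _) (by positivity)

end Frostman

/-! ### The patterns of subcubes -/

section Pattern

/-- A connected finite set of grid points can be enlarged to a connected set of prescribed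
cardinality inside a larger connected set. -/
theorem exists_gridConn_card_eq {ι : Type*} [Fintype ι] {n : ℕ} {P U : Finset (ι → Fin n)} (hPU : P ⊆ U)
    (hP : P.Nonempty) (hPc : ∀ p ∈ P, ∀ q ∈ P, GridConn (P : Set (ι → Fin n)) p q)
    (hUc : ∀ p ∈ U, ∀ q ∈ U, GridConn (U : Set (ι → Fin n)) p q) {t : ℕ} (ht : P.card ≤ t)
    (htU : t ≤ U.card) :
    ∃ B, P ⊆ B ∧ B ⊆ U ∧ B.card = t ∧
      ∀ p ∈ B, ∀ q ∈ B, GridConn (B : Set (ι → Fin n)) p q := by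
  classical
  induction t, ht using Nat.le_induction with
  | base => exact ⟨P, Subset.rfl, hPU, rfl, hPc⟩
  | succ t ht ih =>
    obtain ⟨B, hPB, hBU, hBt, hBc⟩ := ih (by omega)
    obtain ⟨p₀, hp₀⟩ := hP
    have hne : ∃ q₀ ∈ U, q₀ ∉ B := by
      by_contra hcon
      push Not at hcon
      have := Finset.card_le_card (show U ⊆ B from hcon)
      omega
    obtain ⟨q₀, hq₀U, hq₀B⟩ := hne
    -- A path in `U` from `p₀` to a point outside `B` has to leave `B`; the point where it does is
    -- the one to add.
    have hcross : ∃ p ∈ B, ∃ q ∈ U, q ∉ B ∧ (GridSucc p q ∨ GridSucc q p) := by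
      by_contra hcon
      push Not at hcon
      have hc := hUc p₀ (hPU hp₀) q₀ hq₀U
      refine hq₀B ?_
      clear hq₀B hq₀U
      induction hc with
      | refl => exact hPB hp₀
      | tail _ hab ih =>
        by_contra hb
        have := hcon _ ih _ hab.2.1 hb
        rcases hab.2.2 with h | h
        exacts [this.1 h, this.2 h]
    obtain ⟨p, hp, q, hqU, hqB, hpq⟩ := hcross
    have hsub : (B : Set (ι → Fin n)) ⊆ (insert q B : Finset (ι → Fin n)) := by
      intro x hx; simp [Finset.mem_coe.mp hx]
    have key : ∀ x ∈ insert q B, GridConn ((insert q B : Finset (ι → Fin n)) : Set (ι → Fin n)) p x := by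
      intro x hx
      rcases Finset.mem_insert.mp hx with rfl | hx
      · exact Relation.ReflTransGen.single ⟨by simp [hp], by simp, hpq⟩
      · exact (hBc p hp x hx).mono hsub
    refine ⟨insert q B, hPB.trans (Finset.subset_insert _ _), Finset.insert_subset hqU hBU,
      by rw [Finset.card_insert_of_notMem hqB, hBt], fun x hx y hy => (key x hx).symm.trans (key y hy)⟩

variable {ι : Type*} [DecidableEq ι]

/-- The combinatorial requirements on the sets of children of a disconnected cube (`A`) and of a
connected cube (`B`): `A` is a union of full columns in the direction `v`, separated from each
other; `B` is connected and contains the bottoms and the tops of the columns of `A`. -/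
structure IsPattern {L : ℕ} [NeZero L] (v : ι) (A B : Finset (ι → Fin L)) : Prop where
  zero_mem : 0 ∈ A
  update_mem : ∀ p ∈ A, ∀ y, Function.update p v y ∈ A
  even : ∀ p ∈ A, ∀ i, i ≠ v → Even (p i : ℕ)
  bottom : ∀ p ∈ A, p v = 0 → p ∈ B
  top : ∀ p ∈ A, (p v : ℕ) + 1 = L → p ∈ B
  conn : ∀ p ∈ B, ∀ q ∈ B, GridConn (B : Set (ι → Fin L)) p q

/-- The grid point with doubled coordinates. -/
def dbl {M : ℕ} (s : ι → Fin M) : ι → Fin (2 * M) := fun i => ⟨2 * s i, by omega⟩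

/-- Doubling, followed by a unit step in the direction `i`, moved to the height `e`. -/
def bump {M : ℕ} (v : ι) (s : ι → Fin M) (i : ι) (e : Fin (2 * M)) : ι → Fin (2 * M) :=
  Function.update (Function.update (dbl s) i ⟨2 * s i + 1, by omega⟩) v e

theorem card_filter_eq_zero [Fintype ι] {M : ℕ} [NeZero M] (v : ι) :
    (Finset.univ.filter fun p : ι → Fin M => p v = 0).card = M ^ (Fintype.card ι - 1) := by
  have : (Finset.univ.filter fun p : ι → Fin M => p v = 0) =
      Fintype.piFinset fun i => if i = v then {0} else Finset.univ := by
    ext p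
    simp only [Finset.mem_filter, Finset.mem_univ, true_and, Fintype.mem_piFinset]
    constructor
    · intro h i
      by_cases hi : i = v
      · subst hi; simp [h]
      · simp [hi]
    · intro h
      simpa using h v
  rw [this, Fintype.card_piFinset, ← Finset.mul_prod_erase _ _ (Finset.mem_univ v)]
  rw [Finset.prod_congr rfl (g := fun _ => M)]
  · simp [Finset.card_erase_of_mem]
  · intro i hi
    simp [Finset.ne_of_mem_erase hi]

theorem gridSucc_bump {M : ℕ} {v i : ι} (hi : i ≠ v) (s : ι → Fin M) (e : Fin (2 * M)) :
    GridSucc (Function.update (dbl s) v e) (bump v s i e) := by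
  refine ⟨i, by simp [bump, hi, dbl], fun j hj => ?_⟩
  by_cases hjv : j = v
  · subst hjv; simp [bump]
  · simp [bump, hj, hjv]

theorem gridSucc_bump_dbl {M : ℕ} {v i : ι} (hi : i ≠ v) {s s' : ι → Fin M}
    (h : (s' i : ℕ) = s i + 1) (h' : ∀ j, j ≠ i → s' j = s j) (e : Fin (2 * M)) :
    GridSucc (bump v s i e) (Function.update (dbl s') v e) := by
  refine ⟨i, by simp [bump, hi, dbl, h]; ring, fun j hj => ?_⟩
  by_cases hjv : j = v
  · subst hjv; simp [bump]
  · simp [bump, hj, hjv, dbl, h' j hj]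

/-- Doubling a connected set `S` of `a` points in the hyperplane at height zero separates the
points; the columns over them form `A`. To connect, `P` fills the gaps between neighbouring columns
at the lowest and highest levels only, and adds the coordinate axes, which join the two levels. This
is few enough points to be enlarged to a connected `B` with exactly as many points as `A`. -/
theorem exists_isPattern [Fintype ι] (v : ι) {M a : ℕ} [NeZero (2 * M)] (hM : 2 * Fintype.card ι ≤ M)
    (ha : 2 * Fintype.card ι ≤ a) (ha' : a ≤ M ^ (Fintype.card ι - 1)) :
    ∃ A B : Finset (ι → Fin (2 * M)), A.card = 2 * M * a ∧ B.card = 2 * M * a ∧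
      IsPattern v A B ∧ ∀ i t, Pi.single i t ∈ B := by
  have hcard : 0 < Fintype.card ι := Fintype.card_pos_iff.mpr ⟨v⟩
  have hM0 : 0 < M := by omega
  have : NeZero M := ⟨hM0.ne'⟩
  let U : Finset (ι → Fin M) := Finset.univ.filter fun p => p v = 0
  have hUlow : IsLowerSet (U : Set (ι → Fin M)) := by
    intro p q hqp hp
    simp only [U, Finset.coe_filter, Finset.mem_univ, true_and, mem_ofPred_eq] at hp ⊢
    have := hqp v
    rw [hp] at this
    exact le_antisymm this (Fin.zero_le _)
  obtain ⟨S, h0S, hSU, hSa, hSc⟩ := exists_gridConn_card_eq (P := {0}) (U := U) (t := a)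
    (by simp [U]) (by simp) (by
      intro p hp q hq
      rw [Finset.mem_singleton.mp hp, Finset.mem_singleton.mp hq]
      exact Relation.ReflTransGen.refl) (fun p hp q hq => hUlow.gridConn hp hq)
    (by simp; omega) (by rw [card_filter_eq_zero]; exact ha')
  rw [Finset.singleton_subset_iff] at h0S
  have hSv : ∀ s ∈ S, s v = 0 := fun s hs => by simpa [U] using hSU hs
  let A : Finset (ι → Fin (2 * M)) :=
    (S ×ˢ Finset.univ).image fun x => Function.update (dbl x.1) v x.2
  have hA : A.card = 2 * M * a := by
    rw [Finset.card_image_of_injOn, Finset.card_product, hSa]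
    · simp [mul_comm]
    · rintro ⟨s, y⟩ hs ⟨s', y'⟩ hs' h
      simp only [Finset.coe_product, mem_prod, Finset.mem_coe] at hs hs'
      simp only at h
      have hy : y = y' := by simpa using congrFun h v
      have hss : s = s' := by
        funext i
        by_cases hi : i = v
        · subst hi; rw [hSv s hs.1, hSv s' hs'.1]
        · have := congrFun h i
          simp only [Function.update_of_ne hi, dbl, Fin.mk.injEq] at this
          exact Fin.ext (by omega)
      rw [hy, hss]
  let last : Fin (2 * M) := ⟨2 * M - 1, by omega⟩
  let P₁ : Finset (ι → Fin (2 * M)) :=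
    ((S ×ˢ Finset.univ) ×ˢ {0, last}).image fun x => bump v x.1.1 x.1.2 x.2
  let P₂ : Finset (ι → Fin (2 * M)) :=
    (Finset.univ ×ˢ Finset.univ).image fun x : ι × Fin (2 * M) => Pi.single x.1 x.2
  let P := P₁ ∪ P₂
  -- The bumps number at most `2 * a * card ι ≤ a * M` and the axis points at most `2 * M * card ι ≤
  -- a * M`; this is where the two lower bounds on `M` and `a` are needed.
  have hPcard : P.card ≤ 2 * M * a := by
    have h1 : P₁.card ≤ a * Fintype.card ι * 2 := by
      refine Finset.card_image_le.trans ?_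
      rw [Finset.card_product, Finset.card_product, hSa, Finset.card_univ]
      exact Nat.mul_le_mul_left _ Finset.card_le_two
    have h2 : P₂.card ≤ Fintype.card ι * (2 * M) := by
      refine Finset.card_image_le.trans ?_
      simp
    have h3 : P.card ≤ P₁.card + P₂.card := Finset.card_union_le _ _
    have h4 : a * (2 * Fintype.card ι) ≤ a * M := Nat.mul_le_mul_left _ hM
    have h5 : 2 * Fintype.card ι * M ≤ a * M := Nat.mul_le_mul_right _ ha
    have h6 : a * Fintype.card ι * 2 = a * (2 * Fintype.card ι) := by ring
    have h7 : Fintype.card ι * (2 * M) = 2 * Fintype.card ι * M := by ring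
    have h8 : 2 * M * a = a * M + a * M := by ring
    omega
  have hP₁ : ∀ s ∈ S, ∀ i, ∀ e, e = 0 ∨ e = last → bump v s i e ∈ P := by
    intro s hs i e he
    refine Finset.mem_union_left _ (Finset.mem_image.mpr ⟨((s, i), e), ?_, rfl⟩)
    simpa [hs] using he
  -- For `i = v` a bump is just an end of a column, so `P₁` already contains all of these.
  have hbv : ∀ (s : ι → Fin M) e, bump v s v e = Function.update (dbl s) v e := by
    intro s e; simp [bump]
  have hPv : ∀ s ∈ S, ∀ e, e = 0 ∨ e = last → Function.update (dbl s) v e ∈ P := by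
    intro s hs e he
    rw [← hbv]; exact hP₁ s hs v e he
  have hP₂ : ∀ i t, Pi.single i t ∈ P := fun i t =>
    Finset.mem_union_right _ (Finset.mem_image.mpr ⟨(i, t), by simp, rfl⟩)
  have h0P : (0 : ι → Fin (2 * M)) ∈ P := by
    have := hP₂ v 0
    rwa [Pi.single_zero] at this
  have haxis : ∀ i (k : ℕ) (hk : k < 2 * M), GridConn (P : Set (ι → Fin (2 * M))) 0
      (Pi.single i ⟨k, hk⟩) := by
    intro i k
    induction k with
    | zero =>
      intro hk
      have : (⟨0, hk⟩ : Fin (2 * M)) = 0 := by ext; simp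
      rw [this, Pi.single_zero]
      exact Relation.ReflTransGen.refl
    | succ k ih =>
      intro hk
      refine (ih (by omega)).trans (GridConn.succ (hP₂ _ _) (hP₂ _ _) ⟨i, by simp, fun j hj => ?_⟩)
      simp [hj]
  have hcol : ∀ e, e = 0 ∨ e = last → ∀ s ∈ S,
      GridConn (P : Set (ι → Fin (2 * M))) 0 (Function.update (dbl s) v e) := by
    intro e he s hs
    have hc := hSc 0 h0S s hs
    clear hs
    induction hc with
    | refl =>
      have : Function.update (dbl (0 : ι → Fin M)) v e = Pi.single v ⟨e, e.2⟩ := by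
        funext j
        by_cases hj : j = v
        · subst hj; simp
        · simp only [Function.update_of_ne hj, Pi.single_eq_of_ne hj]
          ext; simp [dbl]
      rw [this]
      exact haxis v e e.2
    | tail _ hab ih =>
      rename_i b c _
      refine ih.trans ?_
      have hstep : ∀ b ∈ S, ∀ c ∈ S, GridSucc b c → GridConn (P : Set (ι → Fin (2 * M)))
          (Function.update (dbl b) v e) (Function.update (dbl c) v e) := by
        rintro b hb c hc ⟨i, h1, h2⟩
        have hi : i ≠ v := by
          rintro rfl
          rw [hSv b hb, hSv c hc] at h1
          omega
        exact (GridConn.succ (hPv b hb e he) (hP₁ b hb i e he) (gridSucc_bump hi b e)).trans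
          (GridConn.succ (hP₁ b hb i e he) (hPv c hc e he) (gridSucc_bump_dbl hi h1 h2 e))
      rcases hab.2.2 with h | h
      · exact hstep b hab.1 c hab.2.1 h
      · exact (hstep c hab.2.1 b hab.1 h).symm
  have hall : ∀ p ∈ P, GridConn (P : Set (ι → Fin (2 * M))) 0 p := by
    intro p hp
    rcases Finset.mem_union.mp hp with hp | hp
    · obtain ⟨⟨⟨s, i⟩, e⟩, hx, rfl⟩ := Finset.mem_image.mp hp
      have hx' : s ∈ S ∧ (e = 0 ∨ e = last) := by simpa using hx
      refine (hcol e hx'.2 s hx'.1).trans ?_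
      by_cases hi : i = v
      · subst hi
        simp only [hbv]
        exact Relation.ReflTransGen.refl
      · exact GridConn.succ (hPv s hx'.1 e hx'.2) (hP₁ s hx'.1 i e hx'.2) (gridSucc_bump hi s e)
    · obtain ⟨⟨i, t⟩, _, rfl⟩ := Finset.mem_image.mp hp
      exact haxis i t t.2
  obtain ⟨B, hPB, -, hB, hBc⟩ := exists_gridConn_card_eq (P := P) (U := Finset.univ)
    (t := 2 * M * a) (Finset.subset_univ _) ⟨0, h0P⟩
    (fun p hp q hq => (hall p hp).symm.trans (hall q hq))
    (fun p _ q _ => by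
      rw [Finset.coe_univ]
      exact isLowerSet_univ.gridConn (mem_univ _) (mem_univ _)) hPcard (by
      simp only [Finset.card_univ, Fintype.card_pi, Fintype.card_fin, Finset.prod_const]
      calc 2 * M * a ≤ 2 * M * (2 * M) ^ (Fintype.card ι - 1) :=
            Nat.mul_le_mul_left _ (ha'.trans (Nat.pow_le_pow_left (by omega) _))
        _ = (2 * M) ^ Fintype.card ι := by
            rw [← pow_succ', Nat.sub_add_cancel hcard])
  have hAmem : ∀ p ∈ A, ∃ s ∈ S, ∃ y, p = Function.update (dbl s) v y := by
    intro p hp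
    obtain ⟨⟨s, y⟩, hx, rfl⟩ := Finset.mem_image.mp hp
    exact ⟨s, by simpa using hx, y, rfl⟩
  have hmemA : ∀ s ∈ S, ∀ y, Function.update (dbl s) v y ∈ A := fun s hs y =>
    Finset.mem_image.mpr ⟨(s, y), by simp [hs], rfl⟩
  refine ⟨A, B, hA, hB, ⟨?_, ?_, ?_, ?_, ?_, hBc⟩, fun i t => hPB (hP₂ i t)⟩
  · have := hmemA 0 h0S 0
    convert! this using 1
    funext j
    by_cases hj : j = v
    · subst hj; simp
    · rw [Function.update_of_ne hj]; ext; simp [dbl]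
  · intro p hp y
    obtain ⟨s, hs, y', rfl⟩ := hAmem p hp
    rw [Function.update_idem]
    exact hmemA s hs y
  · intro p hp i hi
    obtain ⟨s, hs, y', rfl⟩ := hAmem p hp
    rw [Function.update_of_ne hi]
    exact ⟨s i, by simp [dbl]; ring⟩
  · intro p hp hpv
    obtain ⟨s, hs, y', rfl⟩ := hAmem p hp
    rw [Function.update_self] at hpv
    exact hPB (hPv s hs y' (Or.inl hpv))
  · intro p hp hpv
    obtain ⟨s, hs, y', rfl⟩ := hAmem p hp
    rw [Function.update_self] at hpv
    exact hPB (hPv s hs y' (Or.inr (Fin.ext (by simp only [last]; omega))))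

/-- A single column is a pattern. -/
theorem isPattern_column [Fintype ι] (v : ι) {L : ℕ} [NeZero L] :
    ∃ A : Finset (ι → Fin L), A.card = L ∧ IsPattern v A A ∧ ∀ p ∈ A, ∀ i, i ≠ v → p i = 0 := by
  let A : Finset (ι → Fin L) := Finset.univ.image fun y => Pi.single v y
  have hmem : ∀ y, Pi.single v y ∈ A := fun y => Finset.mem_image.mpr ⟨y, by simp, rfl⟩
  have hconn : ∀ k (hk : k < L), GridConn (A : Set (ι → Fin L)) 0 (Pi.single v ⟨k, hk⟩) := by
    intro k
    induction k with
    | zero =>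
      intro hk
      have : (⟨0, hk⟩ : Fin L) = 0 := by ext; simp
      rw [this, Pi.single_zero]
      exact Relation.ReflTransGen.refl
    | succ k ih =>
      intro hk
      refine (ih (by omega)).trans (GridConn.succ (hmem _) (hmem _) ⟨v, by simp, fun j hj => ?_⟩)
      simp [hj]
  have hA : ∀ p ∈ A, ∃ y, p = Pi.single v y := by
    intro p hp
    obtain ⟨y, _, rfl⟩ := Finset.mem_image.mp hp
    exact ⟨y, rfl⟩
  refine ⟨A, ?_, ⟨?_, ?_, ?_, fun p hp _ => hp, fun p hp _ => hp, ?_⟩, ?_⟩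
  · rw [Finset.card_image_of_injective _ (Pi.single_injective v)]; simp
  · have := hmem 0
    rwa [Pi.single_zero] at this
  · intro p hp y
    obtain ⟨y', rfl⟩ := hA p hp
    rw [Pi.single, Function.update_idem]
    exact hmem y
  · intro p hp i hi
    obtain ⟨y', rfl⟩ := hA p hp
    simp [hi]
  · intro p hp q hq
    obtain ⟨y, rfl⟩ := hA p hp
    obtain ⟨y', rfl⟩ := hA q hq
    exact (hconn y y.2).symm.trans (hconn y' y'.2)
  · intro p hp i hi
    obtain ⟨y', rfl⟩ := hA p hp
    simp [hi]

end Pattern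

/-! ### Choice of the numbers of children -/

section Growth

/-- A sequence of two consecutive natural numbers (after a first term `1`) whose partial products
are comparable with the powers of a given real number between them. -/
theorem exists_seq_prod_comparable {a : ℕ} {x : ℝ} (ha : 1 ≤ a) (hax : (a : ℝ) ≤ x)
    (hxa : x ≤ a + 1) :
    ∃ α : ℕ → ℕ, α 0 = 1 ∧ (∀ k, k ≠ 0 → a ≤ α k ∧ α k ≤ a + 1) ∧
      ∀ k, x⁻¹ * x ^ k ≤ (∏ j ∈ Finset.range k, α j : ℕ) ∧
        ((∏ j ∈ Finset.range k, α j : ℕ) : ℝ) ≤ 2 * x ^ k := by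
  classical
  have ha1 : (1 : ℝ) ≤ a := by exact_mod_cast ha
  have hx1 : 1 ≤ x := ha1.trans hax
  have hx0 : 0 < x := one_pos.trans_le hx1
  -- Greedy choice: the larger factor when the product is at most `x ^ k`, the smaller one
  -- otherwise. The prescribed first factor `1` costs `x⁻¹`, and the upper constant `2` comes from
  -- `a + 1 ≤ 2 * x`.
  let b : ℕ → ℕ → ℕ := fun k p => if k = 0 then 1 else if (p : ℝ) ≤ x ^ k then a + 1 else a
  obtain ⟨P, hP0, hP⟩ : ∃ P : ℕ → ℕ, P 0 = 1 ∧ ∀ k, P (k + 1) = P k * b k (P k) :=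
    ⟨fun k => Nat.rec 1 (fun k p => p * b k p) k, rfl, fun _ => rfl⟩
  have hprod : ∀ k, ∏ j ∈ Finset.range k, b j (P j) = P k := by
    intro k
    induction k with
    | zero => simp [hP0]
    | succ k ih => rw [Finset.prod_range_succ, ih, hP]
  refine ⟨fun k => b k (P k), by simp [b], ?_, ?_⟩
  · intro k hk
    simp only [b, if_neg hk]
    split_ifs <;> omega
  · intro k
    rw [hprod]
    induction k with
    | zero =>
      rw [hP0]
      simp only [pow_zero, mul_one, Nat.cast_one]
      exact ⟨inv_le_one_of_one_le₀ hx1, by norm_num⟩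
    | succ k ih =>
      have hxk : 0 < x ^ k := by positivity
      rw [hP, pow_succ]
      by_cases hk : k = 0
      · subst hk
        simp only [hP0, b]
        simp only [pow_zero, one_mul, if_true, mul_one, Nat.cast_one]
        refine ⟨(inv_mul_cancel₀ hx0.ne').le, by linarith⟩
      · by_cases hle : ((P k : ℕ) : ℝ) ≤ x ^ k
        · have hb : b k (P k) = a + 1 := by simp only [b, if_neg hk, if_pos hle]
          rw [hb]
          push_cast
          constructor
          · rw [← mul_assoc]
            exact mul_le_mul ih.1 hxa hx0.le (Nat.cast_nonneg _)
          · calc (P k : ℝ) * (a + 1) ≤ x ^ k * (2 * x) :=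
                  mul_le_mul hle (by linarith) (by positivity) hxk.le
              _ = 2 * (x ^ k * x) := by ring
        · have hb : b k (P k) = a := by simp only [b, if_neg hk, if_neg hle]
          rw [hb]
          push_cast
          push Not at hle
          constructor
          · calc x⁻¹ * (x ^ k * x) = x ^ k * 1 := by field_simp
              _ ≤ P k * a := mul_le_mul hle.le ha1 (by norm_num) (Nat.cast_nonneg _)
          · rw [← mul_assoc]
            exact mul_le_mul ih.2 hax (Nat.cast_nonneg _) (by positivity)

/-- With `a` the integer part of `(2 * M) ^ (s - 1)`, the room condition `a + 1 ≤ M ^ (N - 1)` holds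
for large `M` because `s < N`. -/
theorem exists_scale {N : ℕ} {s : ℝ} (hs1 : 1 < s) (hsN : s < N) :
    ∃ M a : ℕ, 2 * N ≤ M ∧ 2 * N ≤ a ∧ a + 1 ≤ M ^ (N - 1) ∧
      (a : ℝ) ≤ ((2 * M : ℕ) : ℝ) ^ (s - 1) ∧ ((2 * M : ℕ) : ℝ) ^ (s - 1) ≤ a + 1 := by
  have hN1 : (1 : ℝ) < N := hs1.trans hsN
  have hN : 1 ≤ N := by exact_mod_cast hN1.le
  have h1 : Filter.Tendsto (fun M : ℕ => (M : ℝ) ^ (s - 1)) Filter.atTop Filter.atTop :=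
    (tendsto_rpow_atTop (by linarith)).comp tendsto_natCast_atTop_atTop
  have h2 : Filter.Tendsto (fun M : ℕ => (M : ℝ) ^ ((N : ℝ) - s)) Filter.atTop Filter.atTop :=
    (tendsto_rpow_atTop (by linarith)).comp tendsto_natCast_atTop_atTop
  obtain ⟨M, hM1, hM2, hM3⟩ := ((h1.eventually_ge_atTop ((2 * N : ℕ) : ℝ)).and
    ((h2.eventually_ge_atTop ((2 : ℝ) ^ (s - 1) + 1)).and
      (Filter.eventually_ge_atTop (2 * N)))).exists
  have hM0 : (0 : ℝ) < M := by
    have : 0 < M := by omega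
    exact_mod_cast this
  have hM01 : (1 : ℝ) ≤ (M : ℝ) ^ (s - 1) := by
    refine le_trans ?_ hM1
    exact_mod_cast (by omega : 1 ≤ 2 * N)
  have hpos : 0 ≤ ((2 * M : ℕ) : ℝ) ^ (s - 1) := by positivity
  have hmul : ((2 * M : ℕ) : ℝ) ^ (s - 1) = 2 ^ (s - 1) * (M : ℝ) ^ (s - 1) := by
    push_cast
    rw [Real.mul_rpow (by norm_num) hM0.le]
  have h2s : (1 : ℝ) ≤ 2 ^ (s - 1) := Real.one_le_rpow (by norm_num) (by linarith)
  refine ⟨M, ⌊((2 * M : ℕ) : ℝ) ^ (s - 1)⌋₊, hM3, ?_, ?_, Nat.floor_le hpos,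
    (Nat.lt_floor_add_one _).le⟩
  · apply Nat.le_floor
    rw [hmul]
    nlinarith
  · have key : (⌊((2 * M : ℕ) : ℝ) ^ (s - 1)⌋₊ : ℝ) + 1 ≤ (M : ℝ) ^ (N - 1) := by
      calc (⌊((2 * M : ℕ) : ℝ) ^ (s - 1)⌋₊ : ℝ) + 1
          ≤ 2 ^ (s - 1) * (M : ℝ) ^ (s - 1) + 1 := by
            rw [← hmul]; linarith [Nat.floor_le hpos]
        _ ≤ (2 ^ (s - 1) + 1) * (M : ℝ) ^ (s - 1) := by linarith
        _ ≤ (M : ℝ) ^ ((N : ℝ) - s) * (M : ℝ) ^ (s - 1) :=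
            mul_le_mul_of_nonneg_right hM2 (by positivity)
        _ = (M : ℝ) ^ (N - 1) := by
            rw [← Real.rpow_add hM0, ← Real.rpow_natCast, Nat.cast_sub hN]
            congr 1
            push_cast
            ring
    exact_mod_cast key

/-- `c (L ^ k) ^ s ≤ ∏_{j < k} n_j ≤ C (L ^ k) ^ s` with `n_j = L α_j`. -/
theorem prod_mul_comparable {L : ℕ} (hL : 0 < L) {s : ℝ} {α : ℕ → ℕ} {c C : ℝ}
    (h : ∀ k, c * ((L : ℝ) ^ (s - 1)) ^ k ≤ (∏ j ∈ Finset.range k, α j : ℕ) ∧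
        ((∏ j ∈ Finset.range k, α j : ℕ) : ℝ) ≤ C * ((L : ℝ) ^ (s - 1)) ^ k) (k : ℕ) :
    c * ((L : ℝ) ^ k) ^ s ≤ (∏ j ∈ Finset.range k, (L * α j) : ℕ) ∧
      ((∏ j ∈ Finset.range k, (L * α j) : ℕ) : ℝ) ≤ C * ((L : ℝ) ^ k) ^ s := by
  have hL0 : (0 : ℝ) < L := by exact_mod_cast hL
  have e : ((L : ℝ) ^ k) ^ s = (L : ℝ) ^ k * ((L : ℝ) ^ (s - 1)) ^ k := by
    rw [← Real.rpow_natCast, ← Real.rpow_natCast, ← Real.rpow_mul hL0.le, ← Real.rpow_mul hL0.le,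
      ← Real.rpow_add hL0]
    congr 1
    ring
  have e2 : (∏ j ∈ Finset.range k, (L * α j)) = L ^ k * ∏ j ∈ Finset.range k, α j := by
    rw [Finset.prod_mul_distrib]; simp
  rw [e, e2, Nat.cast_mul, Nat.cast_pow]
  have hLk : (0 : ℝ) ≤ (L : ℝ) ^ k := by positivity
  constructor
  · calc c * ((L : ℝ) ^ k * ((L : ℝ) ^ (s - 1)) ^ k) = (L : ℝ) ^ k * (c * ((L : ℝ) ^ (s - 1)) ^ k) := by ring
      _ ≤ _ := mul_le_mul_of_nonneg_left (h k).1 hLk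
  · calc (L : ℝ) ^ k * ((∏ j ∈ Finset.range k, α j : ℕ) : ℝ)
        ≤ (L : ℝ) ^ k * (C * ((L : ℝ) ^ (s - 1)) ^ k) := mul_le_mul_of_nonneg_left (h k).2 hLk
      _ = _ := by ring

end Growth

/-! ### Expansions in base `L` -/

section Digits

variable {L : ℕ}

/-- The integer with base `L` digits `a 0, …, a (k - 1)`, most significant digit first. -/
def digitPos (a : ℕ → Fin L) : ℕ → ℕ
  | 0 => 0
  | k + 1 => L * digitPos a k + a k

theorem digitPos_congr {a b : ℕ → Fin L} {k : ℕ} (h : ∀ j < k, a j = b j) :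
    digitPos a k = digitPos b k := by
  induction k with
  | zero => rfl
  | succ k ih => rw [digitPos, digitPos, ih fun j hj => h j (by omega), h k (by omega)]

theorem digitPos_mono {a b : ℕ → Fin L} (h : ∀ j, a j ≤ b j) (k : ℕ) :
    digitPos a k ≤ digitPos b k := by
  induction k with
  | zero => rfl
  | succ k ih => exact Nat.add_le_add (Nat.mul_le_mul_left _ ih) (h k)

theorem eq_of_digitPos_eq {a b : ℕ → Fin L} {k : ℕ} (h : digitPos a k = digitPos b k) :
    ∀ j < k, a j = b j := by
  induction k with
  | zero => intro j hj; omega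
  | succ k ih =>
    rw [digitPos, digitPos] at h
    have hL : 0 < L := (Nat.zero_le _).trans_lt (a k).2
    have h1 : digitPos a k = digitPos b k := by
      have := congrArg (· / L) h
      simpa [Nat.mul_add_div hL, Nat.div_eq_of_lt] using this
    rw [h1] at h
    intro j hj
    rcases Nat.lt_succ_iff_lt_or_eq.mp hj with hj | rfl
    · exact ih h1 j hj
    · exact Fin.ext (by omega)

/-- After scaling by `L ^ k`, the first `k` digits give the integer `digitPos a k` and the tail is a
number in `[0, 1]`. -/
theorem pow_mul_ofDigits_mem [NeZero L] (a : ℕ → Fin L) (k : ℕ) :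
    (L : ℝ) ^ k * Real.ofDigits a ∈ Icc (digitPos a k : ℝ) (digitPos a k + 1) := by
  have hL : (L : ℝ) ≠ 0 := by exact_mod_cast NeZero.ne L
  have hsum : (L : ℝ) ^ k * ∑ i ∈ Finset.range k, Real.ofDigitsTerm a i = digitPos a k := by
    induction k with
    | zero => simp [digitPos]
    | succ k ih =>
      rw [Finset.sum_range_succ, mul_add, pow_succ', mul_assoc, ih, digitPos, Real.ofDigitsTerm]
      push_cast
      congr 1
      field_simp
      ring
  have h := Real.ofDigits_eq_sum_add_ofDigits a k
  rw [h, mul_add, hsum, ← mul_assoc, mul_inv_cancel₀ (by positivity), one_mul]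
  constructor
  · linarith [Real.ofDigits_nonneg fun i => a (i + k)]
  · linarith [Real.ofDigits_le_one fun i => a (i + k)]

theorem digitPos_succ_of_carry {a b : ℕ → Fin L} {t : ℕ} (h : ∀ j < t, a j = b j)
    (ht : (b t : ℕ) = a t + 1) (h' : ∀ j > t, (a j : ℕ) + 1 = L ∧ (b j : ℕ) = 0) {k : ℕ}
    (hk : t < k) : digitPos b k = digitPos a k + 1 := by
  induction k, hk using Nat.le_induction with
  | base => rw [digitPos, digitPos, digitPos_congr h, ht]; rfl
  | succ k hk ih =>
    obtain ⟨h1, h2⟩ := h' k hk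
    rw [digitPos, digitPos, ih, h2, mul_add]
    omega

/-- The two expansions of an `L`-adic rational. -/
theorem ofDigits_eq_of_carry (hL : 1 < L) {a b : ℕ → Fin L} {t : ℕ} (h : ∀ j < t, a j = b j)
    (ht : (b t : ℕ) = a t + 1) (h' : ∀ j > t, (a j : ℕ) + 1 = L ∧ (b j : ℕ) = 0) :
    Real.ofDigits a = Real.ofDigits b := by
  have : NeZero L := ⟨by omega⟩
  have hL1 : (1 : ℝ) < L := by exact_mod_cast hL
  refine eq_of_abs_sub_nonpos ?_
  refine le_of_forall_pos_lt_add fun ε hε => ?_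
  obtain ⟨k, hk⟩ := exists_pow_lt_of_lt_one (show 0 < ε / 2 by positivity) (inv_lt_one_of_one_lt₀ hL1)
  set n := max k (t + 1)
  have hn : (L : ℝ)⁻¹ ^ n ≤ (L : ℝ)⁻¹ ^ k :=
    pow_le_pow_of_le_one (by positivity) (inv_lt_one_of_one_lt₀ hL1).le (le_max_left _ _)
  have h1 := pow_mul_ofDigits_mem a n
  have h2 := pow_mul_ofDigits_mem b n
  rw [digitPos_succ_of_carry h ht h' (show t < n from le_max_right k (t + 1))] at h2
  push_cast at h2
  have hpos : (0 : ℝ) < (L : ℝ) ^ n := by positivity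
  have h3 : (L : ℝ) ^ n * |Real.ofDigits a - Real.ofDigits b| ≤ 2 := by
    have e : (L : ℝ) ^ n * |Real.ofDigits a - Real.ofDigits b| =
        |(L : ℝ) ^ n * (Real.ofDigits a - Real.ofDigits b)| := by rw [abs_mul, abs_of_pos hpos]
    rw [e, mul_sub, abs_le]
    constructor <;> linarith [h1.1, h1.2, h2.1, h2.2]
  have h4 : |Real.ofDigits a - Real.ofDigits b| ≤ 2 * (L : ℝ)⁻¹ ^ n := by
    rw [inv_pow, ← div_eq_mul_inv, le_div_iff₀ hpos]; linarith
  linarith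

/-- When the first distinct digits differ by at least two, a whole `L`-adic interval of level `t +
1` separates the two numbers. -/
theorem inv_pow_le_abs_ofDigits_sub [NeZero L] {a b : ℕ → Fin L} {t : ℕ} (h : ∀ j < t, a j = b j)
    (ht : (a t : ℕ) + 2 ≤ b t) :
    ((L : ℝ) ^ (t + 1))⁻¹ ≤ |Real.ofDigits a - Real.ofDigits b| := by
  have hL : (0 : ℝ) < L := by exact_mod_cast Nat.pos_of_ne_zero (NeZero.ne L)
  have h1 := (pow_mul_ofDigits_mem a (t + 1)).2
  have h2 := (pow_mul_ofDigits_mem b (t + 1)).1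
  rw [digitPos, digitPos_congr h] at h1
  rw [digitPos] at h2
  have ht' : ((a t : ℕ) : ℝ) + 2 ≤ (b t : ℕ) := by exact_mod_cast ht
  push_cast at h1 h2
  have hpos : (0 : ℝ) < (L : ℝ) ^ (t + 1) := by positivity
  have h3 : 1 ≤ (L : ℝ) ^ (t + 1) * (Real.ofDigits b - Real.ofDigits a) := by
    rw [mul_sub]; linarith
  rw [abs_sub_comm, inv_eq_one_div, div_le_iff₀ hpos]
  calc 1 ≤ (L : ℝ) ^ (t + 1) * (Real.ofDigits b - Real.ofDigits a) := h3
    _ ≤ (L : ℝ) ^ (t + 1) * |Real.ofDigits b - Real.ofDigits a| :=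
      mul_le_mul_of_nonneg_left (le_abs_self _) hpos.le
    _ = _ := mul_comm _ _

end Digits

/-- The data of a Moran construction in the grids of mesh `L ^ (-k)`: a disconnected cube of level
`k` is replaced by the subcubes in `A k`, a connected one by those in `B k`. -/
structure Carpet (ι : Type*) [DecidableEq ι] (L : ℕ) [NeZero L] where
  /-- the vertical direction -/
  v : ι
  /-- children of disconnected cubes -/
  A : ℕ → Finset (ι → Fin L)
  /-- children of connected cubes -/
  B : ℕ → Finset (ι → Fin L)
  isPattern : ∀ k, IsPattern v (A k) (B k)
  -- The axes let a linked cube reach the corners of its neighbours. Level zero is excluded since no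
  -- cube is linked there.
  axis_mem : ∀ k, k ≠ 0 → ∀ i t, Pi.single i t ∈ B k
  card_eq : ∀ k, (A k).card = (B k).card
  -- A single column at the root makes the whole carpet one column piece, hence connected.
  root : ∀ p ∈ A 0, ∀ i, i ≠ v → p i = 0
  one_lt : 1 < L

/-! ### Addresses, linked cubes and connectedness of the carpet -/

namespace Carpet

variable {ι : Type*} {L : ℕ}

/-- The point with a given address. -/
noncomputable def point (δ : ℕ → ι → Fin L) : EuclideanSpace ℝ ι :=
  WithLp.toLp 2 fun i => Real.ofDigits fun k => δ k i

theorem point_apply (δ : ℕ → ι → Fin L) (i : ι) :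
    (point δ : EuclideanSpace ℝ ι) i = Real.ofDigits fun k => δ k i := rfl

theorem dist_point_le [Fintype ι] {δ δ' : ℕ → ι → Fin L} {k : ℕ} (h : ∀ j < k, δ j = δ' j) :
    dist (point δ) (point δ') ≤ Fintype.card ι * ((L : ℝ) ^ k)⁻¹ :=
  EuclideanSpace.dist_le_card_mul (by positivity) fun i =>
    Real.abs_ofDigits_sub_ofDigits_le fun j hj => by rw [h j hj]

theorem exists_mesh_lt [Fintype ι] (hL : 1 < L) {η : ℝ} (hη : 0 < η) :
    ∃ K : ℕ, ∀ k, K ≤ k → (Fintype.card ι : ℝ) * ((L : ℝ) ^ k)⁻¹ < η := by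
  have hL1 : (1 : ℝ) < L := by exact_mod_cast hL
  have hlim : Filter.Tendsto (fun k : ℕ => (Fintype.card ι : ℝ) * ((L : ℝ) ^ k)⁻¹) Filter.atTop
      (nhds ((Fintype.card ι : ℝ) * 0)) := by
    refine Filter.Tendsto.const_mul _ ?_
    simp_rw [← inv_pow]
    exact tendsto_pow_atTop_nhds_zero_of_lt_one (by positivity) (inv_lt_one_of_one_lt₀ hL1)
  rw [mul_zero] at hlim
  exact Filter.eventually_atTop.mp (hlim.eventually_lt_const hη)

/-- The address that follows `δ` below the level `k`, then moves to the subcube `p` and then to the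
subcubes `q`. -/
def extend (δ : ℕ → ι → Fin L) (k : ℕ) (p q : ι → Fin L) : ℕ → ι → Fin L :=
  fun j => if j < k then δ j else if j = k then p else q

theorem extend_of_lt {δ : ℕ → ι → Fin L} {k : ℕ} {p q : ι → Fin L} {j : ℕ} (hj : j < k) :
    extend δ k p q j = δ j := if_pos hj

theorem point_eq_of_carry (hL : 1 < L) {δ δ' : ℕ → ι → Fin L} {t : ℕ} {i : ι}
    (hne : ∀ j i', i' ≠ i → δ j i' = δ' j i') (h : ∀ j < t, δ j i = δ' j i)
    (ht : (δ' t i : ℕ) = δ t i + 1) (h' : ∀ j > t, (δ j i : ℕ) + 1 = L ∧ (δ' j i : ℕ) = 0) :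
    (point δ : EuclideanSpace ℝ ι) = point δ' := by
  ext i'
  rw [point_apply, point_apply]
  by_cases hi : i' = i
  · subst hi
    exact ofDigits_eq_of_carry hL h ht h'
  · congr 1
    funext k
    exact hne k i' hi

variable [DecidableEq ι] [NeZero L] (c : Carpet ι L)

/-- A cube of level `k` is connected when the vertical digits of its address vanish on one of the
blocks `[2 ^ i - 1, 2 ^ (i + 1) - 1)` below `k`. -/
def Linked (δ : ℕ → ι → Fin L) (k : ℕ) : Prop :=
  ∃ i, 2 ^ (i + 1) - 1 ≤ k ∧ ∀ j, 2 ^ i - 1 ≤ j → j < 2 ^ (i + 1) - 1 → δ j c.v = 0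

/-- Addresses of the points of the carpet. -/
def Adm (δ : ℕ → ι → Fin L) : Prop :=
  ∀ k, (c.Linked δ k → δ k ∈ c.B k) ∧ (¬ c.Linked δ k → δ k ∈ c.A k)

/-- The carpet. -/
def carrier : Set (EuclideanSpace ℝ ι) := point '' {δ | c.Adm δ}

/-- The part of the carpet in the cube of level `k` containing the point of address `δ`. -/
def cell (δ : ℕ → ι → Fin L) (k : ℕ) : Set (EuclideanSpace ℝ ι) :=
  point '' {δ' | c.Adm δ' ∧ ∀ j < k, δ' j = δ j}

/-- The part of the carpet in the intersection of a cube of level `k` and a vertical column of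
level `k'`. -/
def colCell (δ : ℕ → ι → Fin L) (k k' : ℕ) : Set (EuclideanSpace ℝ ι) :=
  point '' {δ' | c.Adm δ' ∧ (∀ j < k, δ' j = δ j) ∧ ∀ j < k', ∀ i, i ≠ c.v → δ' j i = δ j i}

variable {c}

theorem Linked.congr {δ δ' : ℕ → ι → Fin L} {k : ℕ} (h : c.Linked δ k)
    (hδ : ∀ j < k, δ' j c.v = δ j c.v) : c.Linked δ' k := by
  obtain ⟨i, hi, hz⟩ := h
  exact ⟨i, hi, fun j hj hj' => by rw [hδ j (hj'.trans_le hi)]; exact hz j hj hj'⟩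

theorem linked_congr {δ δ' : ℕ → ι → Fin L} {k : ℕ} (hδ : ∀ j < k, δ' j = δ j) :
    c.Linked δ' k ↔ c.Linked δ k :=
  ⟨fun h => h.congr fun j hj => by rw [hδ j hj], fun h => h.congr fun j hj => by rw [hδ j hj]⟩

theorem Linked.mono {δ : ℕ → ι → Fin L} {k k' : ℕ} (h : c.Linked δ k) (hk : k ≤ k') :
    c.Linked δ k' := by
  obtain ⟨i, hi, hz⟩ := h
  exact ⟨i, hi.trans hk, hz⟩

theorem Linked.ne_zero {δ : ℕ → ι → Fin L} {k : ℕ} (h : c.Linked δ k) : k ≠ 0 := by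
  obtain ⟨i, hi, -⟩ := h
  have : 2 ^ 1 ≤ 2 ^ (i + 1) := Nat.pow_le_pow_right (by norm_num) (by omega)
  omega

/-- Cubes become connected only at the ends of blocks. -/
theorem Linked.of_lt {δ : ℕ → ι → Fin L} {i k : ℕ} (h : c.Linked δ k)
    (hk : k < 2 ^ (i + 1) - 1) : c.Linked δ (2 ^ i - 1) := by
  obtain ⟨i', hi', hz⟩ := h
  refine ⟨i', ?_, hz⟩
  have h1 : 2 ^ (i' + 1) < 2 ^ (i + 1) := by omega
  have h2 : i' + 1 < i + 1 := (Nat.pow_lt_pow_iff_right (by norm_num)).mp h1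
  have : 2 ^ (i' + 1) ≤ 2 ^ i := Nat.pow_le_pow_right (by norm_num) (by omega)
  omega

theorem zero_mem_A (k : ℕ) : 0 ∈ c.A k := (c.isPattern k).zero_mem

theorem zero_mem_B (k : ℕ) : 0 ∈ c.B k := (c.isPattern k).bottom 0 (zero_mem_A k) rfl

/-- A modification of the tail of an admissible address. -/
theorem Adm.modify {δ δ' : ℕ → ι → Fin L} {k : ℕ} (h : c.Adm δ) (hδ : ∀ j < k, δ' j = δ j)
    (hk : ∀ j, k ≤ j → δ' j ∈ c.B j ∧ (δ' j ∈ c.A j ∨ c.Linked δ' j)) : c.Adm δ' := by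
  intro j
  rcases lt_or_ge j k with hj | hj
  · rw [linked_congr fun j' hj' => hδ j' (hj'.trans hj), hδ j hj]
    exact h j
  · exact ⟨fun _ => (hk j hj).1, fun hl => (hk j hj).2.resolve_right hl⟩

theorem mem_cell {δ δ' : ℕ → ι → Fin L} {k : ℕ} (h : c.Adm δ') (h' : ∀ j < k, δ' j = δ j) :
    point δ' ∈ c.cell δ k := ⟨δ', ⟨h, h'⟩, rfl⟩

theorem cell_subset {δ δ' : ℕ → ι → Fin L} {k k' : ℕ} (hk : k ≤ k') (h : ∀ j < k, δ' j = δ j) :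
    c.cell δ' k' ⊆ c.cell δ k := by
  rintro _ ⟨δ'', ⟨h1, h2⟩, rfl⟩
  exact mem_cell h1 fun j hj => by rw [h2 j (hj.trans_le hk), h j hj]

theorem mem_colCell {δ δ' : ℕ → ι → Fin L} {k k' : ℕ} (h : c.Adm δ') (h' : ∀ j < k, δ' j = δ j)
    (h'' : ∀ j < k', ∀ i, i ≠ c.v → δ' j i = δ j i) : point δ' ∈ c.colCell δ k k' :=
  ⟨δ', ⟨h, h', h''⟩, rfl⟩

theorem colCell_subset_cell (δ : ℕ → ι → Fin L) (k k' : ℕ) : c.colCell δ k k' ⊆ c.cell δ k := by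
  rintro _ ⟨δ', ⟨h1, h2, -⟩, rfl⟩
  exact mem_cell h1 h2

theorem adm_zero : c.Adm 0 := fun k => ⟨fun _ => zero_mem_B k, fun _ => zero_mem_A k⟩

theorem not_linked_zero (δ : ℕ → ι → Fin L) : ¬ c.Linked δ 0 := fun h => h.ne_zero rfl

variable [Fintype ι]

theorem dist_le_of_mem_cell {δ : ℕ → ι → Fin L} {k : ℕ} {x y : EuclideanSpace ℝ ι}
    (hx : x ∈ c.cell δ k) (hy : y ∈ c.cell δ k) :
    dist x y ≤ Fintype.card ι * ((L : ℝ) ^ k)⁻¹ := by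
  obtain ⟨δ₁, ⟨-, h1⟩, rfl⟩ := hx
  obtain ⟨δ₂, ⟨-, h2⟩, rfl⟩ := hy
  exact dist_point_le fun j hj => by rw [h1 j hj, h2 j hj]

/-- Downward induction on the level, starting where cubes are smaller than `η`. All descendants of a
linked cube are linked, the pattern `B k` is connected, and the cells of grid neighbours share a
corner. -/
theorem chainIn_cell_of_linked {η : ℝ} (hη : 0 < η) {δ : ℕ → ι → Fin L} {k : ℕ} (hδ : c.Adm δ)
    (hk : c.Linked δ k) {x y : EuclideanSpace ℝ ι} (hx : x ∈ c.cell δ k) (hy : y ∈ c.cell δ k) :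
    ChainIn (c.cell δ k) η x y := by
  obtain ⟨K, hK⟩ := exists_mesh_lt (ι := ι) c.one_lt hη
  have key : ∀ n k, K ≤ k + n → ∀ δ, c.Adm δ → c.Linked δ k → ∀ x ∈ c.cell δ k, ∀ y ∈ c.cell δ k,
      ChainIn (c.cell δ k) η x y := by
    intro n
    induction n with
    | zero =>
      intro k hk δ _ _ x hx y hy
      exact ChainIn.step hx hy ((dist_le_of_mem_cell hx hy).trans_lt (hK k hk))
    | succ n ih =>
      intro k hk δ hδ hl x hx y hy
      have hk0 := hl.ne_zero
      have hadm : ∀ p ∈ c.B k, ∀ q, (∀ j, k < j → q ∈ c.B j) → c.Adm (extend δ k p q) := by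
        intro p hp q hq
        refine hδ.modify (k := k) (fun j hj => extend_of_lt hj) fun j hj => ⟨?_, Or.inr ?_⟩
        · rcases hj.eq_or_lt with rfl | hj'
          · simpa [extend] using hp
          · simpa [extend, hj'.ne', not_lt.mpr hj] using hq j hj'
        · exact ((linked_congr fun j hj => extend_of_lt hj).mpr hl).mono hj
      have hadm0 : ∀ p ∈ c.B k, c.Adm (extend δ k p 0) := fun p hp =>
        hadm p hp 0 fun j _ => zero_mem_B j
      have hlk : ∀ p q, c.Linked (extend δ k p q) (k + 1) := fun p q =>
        ((linked_congr fun j hj => extend_of_lt hj).mpr hl).mono (Nat.le_succ k)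
      have hsub : ∀ p, c.cell (extend δ k p 0) (k + 1) ⊆ c.cell δ k := fun p =>
        cell_subset (Nat.le_succ k) fun j hj => extend_of_lt hj
      have hmem : ∀ p ∈ c.B k, point (extend δ k p 0) ∈ c.cell (extend δ k p 0) (k + 1) :=
        fun p hp => mem_cell (hadm0 p hp) fun _ _ => rfl
      have hsucc : ∀ p ∈ c.B k, ∀ q ∈ c.B k, GridSucc p q →
          ChainIn (c.cell δ k) η (point (extend δ k p 0)) (point (extend δ k q 0)) := by
        rintro p hp q hq ⟨i, hi, hij⟩
        let last : Fin L := ⟨L - 1, by have := c.one_lt; omega⟩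
        have hadm' : c.Adm (extend δ k p (Pi.single i last)) :=
          hadm p hp _ fun j hj => c.axis_mem j (by omega) i last
        -- The lower corner of the cube `q` has a second expansion inside the cube `p`, with all
        -- later digits in direction `i` equal to `L - 1`.
        have heq : (point (extend δ k p (Pi.single i last)) : EuclideanSpace ℝ ι) =
            point (extend δ k q 0) := by
          refine point_eq_of_carry c.one_lt (t := k) (i := i) ?_ ?_ ?_ ?_
          · intro j i' hi'
            simp only [extend]
            split_ifs
            · rfl
            · exact (hij i' hi').symm
            · simp [hi']
          · intro j hj; simp [extend, hj]
          · simpa [extend] using hi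
          · intro j hj
            have h1 : ¬ j < k := by omega
            have h2 : j ≠ k := by omega
            have := c.one_lt
            simp only [extend, if_neg h1, if_neg h2, Pi.single_eq_same, last]
            exact ⟨by omega, by simp⟩
        rw [← heq]
        refine (ih (k + 1) (by omega) _ (hadm0 p hp) (hlk p 0) _ (hmem p hp) _ ?_).mono (hsub p)
        refine mem_cell hadm' fun j hj => ?_
        simp only [extend]
        split_ifs
        · rfl
        · rfl
        · omega
      have hconn : ∀ p q, GridConn (c.B k : Set (ι → Fin L)) p q →
          ChainIn (c.cell δ k) η (point (extend δ k p 0)) (point (extend δ k q 0)) := by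
        intro p q hpq
        induction hpq with
        | refl => exact Relation.ReflTransGen.refl
        | tail _ hab ih' =>
          refine ih'.trans ?_
          rcases hab.2.2 with h | h
          · exact hsucc _ hab.1 _ hab.2.1 h
          · exact (hsucc _ hab.2.1 _ hab.1 h).symm
      have hcenter : ∀ x ∈ c.cell δ k, ∃ p ∈ c.B k,
          ChainIn (c.cell δ k) η x (point (extend δ k p 0)) := by
        rintro _ ⟨δ', ⟨h1, h2⟩, rfl⟩
        have hp : δ' k ∈ c.B k := (h1 k).1 ((linked_congr h2).mpr hl)
        refine ⟨δ' k, hp, ?_⟩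
        refine (ih (k + 1) (by omega) _ (hadm0 _ hp) (hlk _ 0) _ (mem_cell h1 fun j hj => ?_) _
          (hmem _ hp)).mono (hsub _)
        simp only [extend]
        split_ifs with h3 h4
        · exact h2 j h3
        · rw [h4]
        · omega
      obtain ⟨p, hp, hxp⟩ := hcenter x hx
      obtain ⟨q, hq, hyq⟩ := hcenter y hy
      exact hxp.trans ((hconn p q ((c.isPattern k).conn p hp q hq)).trans hyq.symm)
  exact key K k (by omega) δ hδ hk x hx y hy

/-- Every point of the column is chained down to its bottom, where the vertical digits vanish on the
whole block, so that the bottom cube is linked. The descent is an induction on the integer height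
`digitPos` of the point. -/
theorem chainConnected_colCell {δ : ℕ → ι → Fin L} {i : ℕ} (hδ : c.Adm δ)
    (hl : ¬ c.Linked δ (2 ^ i - 1)) :
    ChainConnected (c.colCell δ (2 ^ i - 1) (2 ^ (i + 1) - 1)) := by
  intro η hη
  set k := 2 ^ i - 1 with hk
  set k' := 2 ^ (i + 1) - 1 with hk'
  have hkk' : k ≤ k' := by
    have : 2 ^ i ≤ 2 ^ (i + 1) := Nat.pow_le_pow_right (by norm_num) (Nat.le_succ i)
    omega
  obtain ⟨K, hK⟩ := exists_mesh_lt (ι := ι) c.one_lt hη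
  set J := max K k' with hJ
  have hA : ∀ δ', c.Adm δ' → (∀ j < k, δ' j = δ j) → ∀ j < k', ¬ c.Linked δ' j :=
    fun δ' _ h j hj hlj => hl ((linked_congr h).mp (hlj.of_lt hj))
  -- the bottom of the column
  let b : ℕ → ι → Fin L := fun j =>
    if j < k then δ j else if j < k' then Function.update (δ j) c.v 0 else 0
  have hbA : ∀ j, k ≤ j → b j ∈ c.A j ∧ b j c.v = 0 := by
    intro j hj
    simp only [b, if_neg (not_lt.mpr hj)]
    split_ifs with h
    · exact ⟨(c.isPattern j).update_mem _ ((hδ j).2 (hA δ hδ (fun _ _ => rfl) j h)) _, by simp⟩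
    · exact ⟨zero_mem_A j, rfl⟩
  have hbadm : c.Adm b := hδ.modify (k := k) (fun j hj => by simp [b, hj]) fun j hj =>
    ⟨(c.isPattern j).bottom _ (hbA j hj).1 (hbA j hj).2, Or.inl (hbA j hj).1⟩
  have hblink : c.Linked b k' := ⟨i, le_rfl, fun j hj _ => (hbA j hj).2⟩
  have hbcol : ∀ j < k', ∀ i', i' ≠ c.v → b j i' = δ j i' := by
    intro j hj i' hi'
    simp only [b]
    split_ifs
    · rfl
    · simp [hi']
  have hsubcol : ∀ δ' q, k' ≤ q → (∀ j < k, δ' j = δ j) →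
      (∀ j < k', ∀ i', i' ≠ c.v → δ' j i' = δ j i') → c.cell δ' q ⊆ c.colCell δ k k' := by
    rintro δ' q hq h1 h2 _ ⟨δ'', ⟨h3, h4⟩, rfl⟩
    exact mem_colCell h3 (fun j hj => by rw [h4 j (by omega), h1 j hj])
      fun j hj i' hi' => by rw [h4 j (by omega), h2 j hj i' hi']
  have hbsub : c.cell b k' ⊆ c.colCell δ k k' :=
    hsubcol b k' le_rfl (fun j hj => by simp [b, hj]) hbcol
  have key : ∀ n δ', digitPos (fun j => δ' j c.v) J = n → c.Adm δ' → (∀ j < k, δ' j = δ j) →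
      (∀ j < k', ∀ i', i' ≠ c.v → δ' j i' = δ j i') →
      ChainIn (c.colCell δ k k') η (point δ') (point b) := by
    intro n
    induction n using Nat.strong_induction_on with
    | _ n ih =>
      intro δ' hn hδ' hpre hcol
      classical
      have hex : ∃ q, c.Linked δ' q ∨ J ≤ q := ⟨J, Or.inr le_rfl⟩
      set q := Nat.find hex with hq
      have hqJ : q ≤ J := Nat.find_min' hex (Or.inr le_rfl)
      have hqmin : ∀ j < q, ¬ c.Linked δ' j := fun j hj h => Nat.find_min hex hj (Or.inl h)
      have hqk' : k' ≤ q := by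
        rcases Nat.find_spec hex with h | h
        · by_contra hcon
          exact hA δ' hδ' hpre q (not_le.mp hcon) h
        · exact (le_max_right K k').trans h
      have hAq : ∀ j < q, δ' j ∈ c.A j := fun j hj => (hδ' j).2 (hqmin j hj)
      -- The lower corner of the cube of level `q`. It can be reached since that cube is either
      -- linked or smaller than `η`.
      let δ₁ : ℕ → ι → Fin L := fun j => if j < q then δ' j else 0
      have h1lt : ∀ j < q, δ₁ j = δ' j := fun j hj => if_pos hj
      have h1ge : ∀ j, q ≤ j → δ₁ j = 0 := fun j hj => if_neg (not_lt.mpr hj)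
      have h1A : ∀ j, δ₁ j ∈ c.A j := by
        intro j
        rcases lt_or_ge j q with hj | hj
        · rw [h1lt j hj]; exact hAq j hj
        · rw [h1ge j hj]; exact zero_mem_A j
      have hadm1 : c.Adm δ₁ := hδ'.modify h1lt fun j hj => by
        rw [h1ge j hj]; exact ⟨zero_mem_B j, Or.inl (zero_mem_A j)⟩
      have hstep : ChainIn (c.colCell δ k k') η (point δ') (point δ₁) := by
        rcases Nat.find_spec hex with h | h
        · exact (chainIn_cell_of_linked hη hδ' h (mem_cell hδ' fun _ _ => rfl)
            (mem_cell hadm1 h1lt)).mono (hsubcol δ' q hqk' hpre hcol)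
        · refine ChainIn.step (mem_colCell hδ' hpre hcol)
            (hsubcol δ' q hqk' hpre hcol (mem_cell hadm1 h1lt)) ?_
          exact (dist_point_le fun j hj => (h1lt j hj).symm).trans_lt
            (hK q ((le_max_left K k').trans h))
      refine hstep.trans ?_
      have hn1 : digitPos (fun j => δ₁ j c.v) J ≤ n := by
        rw [← hn]
        refine digitPos_mono (fun j => ?_) J
        rcases lt_or_ge j q with hj | hj
        · rw [h1lt j hj]
        · rw [h1ge j hj]; exact Fin.zero_le _
      -- If the vertical digits vanish from `k` to `q`, the corner already lies in the bottom cube,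
      -- which is chain connected.
      by_cases hzero : ∀ j, k ≤ j → j < q → δ' j c.v = 0
      · refine (chainIn_cell_of_linked hη hbadm hblink (mem_cell hadm1 fun j hj => ?_)
          (mem_cell hbadm fun _ _ => rfl)).mono hbsub
        rw [h1lt j (by omega)]
        simp only [b]
        split_ifs with h
        · exact hpre j h
        · funext i'
          by_cases hi' : i' = c.v
          · subst hi'; simp [hzero j (not_lt.mp h) (by omega)]
          · simp [hi', hcol j hj i' hi']
      · push Not at hzero
        obtain ⟨t, ⟨htk, htq, ht0⟩, htmax⟩ : ∃ t, (k ≤ t ∧ t < q ∧ δ' t c.v ≠ 0) ∧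
            ∀ j, t < j → j < q → δ' j c.v = 0 := by
          obtain ⟨t₀, h1, h2, h3⟩ := hzero
          let p : ℕ → Prop := fun t => k ≤ t ∧ t < q ∧ δ' t c.v ≠ 0
          have hp : p (Nat.findGreatest p q) := Nat.findGreatest_spec h2.le ⟨h1, h2, h3⟩
          refine ⟨Nat.findGreatest p q, hp, fun j hj hjq => ?_⟩
          by_contra hcon
          exact Nat.findGreatest_is_greatest hj hjq.le ⟨hp.1.trans hj.le, hjq, hcon⟩
        have hLpos := c.one_lt
        let last : Fin L := ⟨L - 1, by omega⟩
        -- The other expansion of the same corner: the last nonzero vertical digit drops by one and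
        -- the later ones become `L - 1`. It views the corner as the top of the cube below, one unit
        -- lower in `digitPos`. Tops of columns of `A j` belong to `B j`, so it remains admissible
        -- even where it becomes linked.
        let δ₂ : ℕ → ι → Fin L := fun j => if j < t then δ' j else
          Function.update (δ₁ j) c.v (if j = t then ⟨δ' t c.v - 1, by omega⟩ else last)
        have h2lt : ∀ j < t, δ₂ j = δ' j := fun j hj => if_pos hj
        have h2ge : ∀ j, t ≤ j → δ₂ j = Function.update (δ₁ j) c.v
            (if j = t then ⟨δ' t c.v - 1, by omega⟩ else last) :=
          fun j hj => if_neg (not_lt.mpr hj)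
        have h2A : ∀ j, δ₂ j ∈ c.A j := by
          intro j
          rcases lt_or_ge j t with hj | hj
          · rw [h2lt j hj]; exact hAq j (hj.trans htq)
          · rw [h2ge j hj]; exact (c.isPattern j).update_mem _ (h1A j) _
        have h2v : ∀ j, t < j → (δ₂ j c.v : ℕ) + 1 = L := by
          intro j hj
          rw [h2ge j hj.le, Function.update_self, if_neg hj.ne']
          simp only [last]
          omega
        have hadm2 : c.Adm δ₂ := by
          intro j
          refine ⟨fun hlj => ?_, fun _ => h2A j⟩
          rcases le_or_gt j t with hj | hj
          · exact absurd ((linked_congr fun j' hj' => h2lt j' (hj'.trans_le hj)).mp hlj)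
              (hqmin j (hj.trans_lt htq))
          · exact (c.isPattern j).top _ (h2A j) (h2v j hj)
        have h21 : ∀ j i', i' ≠ c.v → δ₂ j i' = δ₁ j i' := by
          intro j i' hi'
          rcases lt_or_ge j t with hj | hj
          · rw [h2lt j hj, h1lt j (hj.trans htq)]
          · rw [h2ge j hj, Function.update_of_ne hi']
        have hc1 : ∀ j < t, δ₂ j c.v = δ₁ j c.v := fun j hj => by
          rw [h2lt j hj, h1lt j (hj.trans htq)]
        have hc2 : (δ₁ t c.v : ℕ) = δ₂ t c.v + 1 := by
          rw [h1lt t htq, h2ge t le_rfl, Function.update_self, if_pos rfl]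
          have : (δ' t c.v : ℕ) ≠ 0 := fun h => ht0 (Fin.ext (by simpa using h))
          simp only
          omega
        have hc3 : ∀ j > t, (δ₂ j c.v : ℕ) + 1 = L ∧ (δ₁ j c.v : ℕ) = 0 := by
          intro j hj
          refine ⟨h2v j hj, ?_⟩
          rcases lt_or_ge j q with hjq | hjq
          · rw [h1lt j hjq, htmax j hj hjq]; simp
          · rw [h1ge j hjq]; simp
        rw [← point_eq_of_carry c.one_lt h21 hc1 hc2 hc3]
        have hdec := digitPos_succ_of_carry (a := fun j => δ₂ j c.v) (b := fun j => δ₁ j c.v)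
          hc1 hc2 hc3 (htq.trans_le hqJ)
        refine ih _ (by omega) δ₂ rfl hadm2 (fun j hj => ?_) fun j hj i' hi' => ?_
        · rw [h2lt j (by omega), hpre j hj]
        · rw [h21 j i' hi', h1lt j (by omega), hcol j hj i' hi']
  rintro _ ⟨δ₁, ⟨h1, h2, h3⟩, rfl⟩ _ ⟨δ₂, ⟨h4, h5, h6⟩, rfl⟩
  exact (key _ δ₁ rfl h1 h2 h3).trans (key _ δ₂ rfl h4 h5 h6).symm

theorem chainConnected_carrier : ChainConnected c.carrier := by
  have h := chainConnected_colCell (c := c) (i := 0) adm_zero (not_linked_zero 0)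
  convert! h using 1
  refine Subset.antisymm ?_ ?_
  · rintro _ ⟨δ, hδ, rfl⟩
    refine mem_colCell hδ (fun j hj => by simp at hj) fun j hj i hi => ?_
    have hj0 : j = 0 := by simp at hj; omega
    subst hj0
    exact c.root _ ((hδ 0).2 (not_linked_zero δ)) i hi
  · rintro _ ⟨δ, ⟨hδ, -⟩, rfl⟩
    exact ⟨δ, hδ, rfl⟩

/-- The pieces are the linked cells of level `k` and, in the other cubes of that level, the columns
of level `k'`. Each depends on the first `k'` digits only, so there are finitely many. -/
theorem exists_finite_chainConnected_cover {ε : ℝ} (hε : 0 < ε) :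
    ∃ 𝓕 : Set (Set (EuclideanSpace ℝ ι)), 𝓕.Finite ∧ ⋃₀ 𝓕 = c.carrier ∧
      ∀ F ∈ 𝓕, ChainConnected F ∧ ∀ x ∈ F, ∀ y ∈ F, dist x y < ε := by
  classical
  obtain ⟨i, hi⟩ := exists_mesh_lt (ι := ι) c.one_lt hε
  set k := 2 ^ i - 1 with hk
  set k' := 2 ^ (i + 1) - 1 with hk'
  have hik : i ≤ k := by
    have := Nat.lt_two_pow_self (n := i)
    omega
  have hkk' : k ≤ k' := by
    have : 2 ^ i ≤ 2 ^ (i + 1) := Nat.pow_le_pow_right (by norm_num) (Nat.le_succ i)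
    omega
  let F : (ℕ → ι → Fin L) → Set (EuclideanSpace ℝ ι) := fun δ =>
    if c.Linked δ k then c.cell δ k else c.colCell δ k k'
  have hFsub : ∀ δ, F δ ⊆ c.cell δ k := by
    intro δ
    simp only [F]
    split_ifs
    · exact Subset.rfl
    · exact colCell_subset_cell δ k k'
  have hFcongr : ∀ δ δ', (∀ j < k', δ j = δ' j) → F δ = F δ' := by
    intro δ δ' h
    have h1 : c.Linked δ k ↔ c.Linked δ' k := linked_congr fun j hj => h j (by omega)
    have h2 : c.cell δ k = c.cell δ' k :=
      Subset.antisymm (cell_subset le_rfl fun j hj => h j (by omega))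
        (cell_subset le_rfl fun j hj => (h j (by omega)).symm)
    have h3 : c.colCell δ k k' = c.colCell δ' k k' := by
      simp only [colCell]
      congr 1
      ext δ''
      simp only [mem_ofPred_eq]
      refine and_congr_right fun _ => and_congr ?_ ?_
      · exact forall₂_congr fun j hj => by rw [h j (by omega)]
      · exact forall₂_congr fun j hj => by rw [h j hj]
    simp only [F, h1, h2, h3]
  refine ⟨F '' {δ | c.Adm δ}, ?_, ?_, ?_⟩
  · let g : (Fin k' → ι → Fin L) → Set (EuclideanSpace ℝ ι) := fun w =>
      F fun j => if h : j < k' then w ⟨j, h⟩ else 0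
    refine (finite_range g).subset ?_
    rintro _ ⟨δ, -, rfl⟩
    refine ⟨fun j => δ j, hFcongr _ _ fun j hj => ?_⟩
    simp [hj]
  · refine Subset.antisymm ?_ ?_
    · rintro x ⟨_, ⟨δ, -, rfl⟩, hx⟩
      obtain ⟨δ', ⟨h, -⟩, rfl⟩ := hFsub δ hx
      exact ⟨δ', h, rfl⟩
    · rintro _ ⟨δ, hδ, rfl⟩
      refine ⟨F δ, ⟨δ, hδ, rfl⟩, ?_⟩
      simp only [F]
      split_ifs
      · exact mem_cell hδ fun _ _ => rfl
      · exact mem_colCell hδ (fun _ _ => rfl) fun _ _ _ _ => rfl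
  · rintro _ ⟨δ, hδ, rfl⟩
    refine ⟨?_, fun x hx y hy =>
      (dist_le_of_mem_cell (hFsub δ hx) (hFsub δ hy)).trans_lt (hi k hik)⟩
    simp only [F]
    split_ifs with h
    · exact fun η hη x hx y hy => chainIn_cell_of_linked hη hδ h hx hy
    · exact chainConnected_colCell hδ h

end Carpet

/-! ### The natural measure on the carpet -/

namespace Carpet

variable {ι : Type*} [DecidableEq ι] {L : ℕ} [NeZero L] {c : Carpet ι L}

theorem continuous_point {ι : Type*} {L : ℕ} : Continuous (point : (ℕ → ι → Fin L) → EuclideanSpace ℝ ι) := by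
  refine (PiLp.continuous_toLp 2 _).comp (continuous_pi fun i => ?_)
  exact Real.continuous_ofDigits.comp (by fun_prop)

/-- Being linked persists at deeper levels, so the first linked level is decided by the digits
chosen before it. -/
theorem linked_iff_of_agree {δ δ' : ℕ → ι → Fin L} (h : ∀ j, ¬ c.Linked δ j → δ' j = δ j) (k : ℕ) :
    c.Linked δ' k ↔ c.Linked δ k := by
  classical
  constructor
  · intro hl
    by_contra hcon
    exact hcon ((linked_congr fun j hj => h j fun hj' => hcon (hj'.mono hj.le)).mp hl)
  · intro hl
    have hex : ∃ k, c.Linked δ k := ⟨k, hl⟩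
    have := (linked_congr fun j hj => h j (Nat.find_min hex hj)).mpr (Nat.find_spec hex)
    exact this.mono (Nat.find_min' hex hl)

variable (c) in
/-- Sequences of children of disconnected cubes; they code the points of the carpet. -/
abbrev Code : Type _ := ∀ k, c.A k

/-- The sequence of digits underlying a code. -/
def raw (ω : c.Code) : ℕ → ι → Fin L := fun k => (ω k).1

open Classical in
/-- The address coded by `ω`: in connected cubes, the children in `A k` are replaced by those in
`B k`. -/
noncomputable def addr (ω : c.Code) : ℕ → ι → Fin L := fun k =>
  if c.Linked (raw ω) k then (Finset.equivOfCardEq (c.card_eq k) (ω k)).1 else (ω k).1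

theorem linked_addr (ω : c.Code) (k : ℕ) : c.Linked (addr ω) k ↔ c.Linked (raw ω) k :=
  linked_iff_of_agree (fun _ hj => if_neg hj) k

theorem adm_addr (ω : c.Code) : c.Adm (addr ω) := by
  intro k
  rw [linked_addr]
  constructor
  · intro h; rw [addr, if_pos h]; exact Finset.coe_mem _
  · intro h; rw [addr, if_neg h]; exact (ω k).2

theorem Adm.exists_code {δ : ℕ → ι → Fin L} (h : c.Adm δ) : ∃ ω : c.Code, addr ω = δ := by
  classical
  let ω : c.Code := fun k => if hk : c.Linked δ k then
    (Finset.equivOfCardEq (c.card_eq k)).symm ⟨δ k, (h k).1 hk⟩ else ⟨δ k, (h k).2 hk⟩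
  have hω : ∀ k, c.Linked (raw ω) k ↔ c.Linked δ k :=
    linked_iff_of_agree fun j hj => by simp [raw, ω, hj]
  refine ⟨ω, funext fun k => ?_⟩
  by_cases hk : c.Linked δ k
  · rw [addr, if_pos ((hω k).mpr hk)]
    simp [ω, hk]
  · rw [addr, if_neg fun hk' => hk ((hω k).mp hk')]
    simp [ω, hk]

theorem addr_congr {ω ω' : c.Code} {k : ℕ} (h : ∀ j ≤ k, ω j = ω' j) : addr ω k = addr ω' k := by
  have : c.Linked (raw ω) k ↔ c.Linked (raw ω') k :=
    linked_congr fun j hj => by rw [raw, raw, h j hj.le]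
  by_cases hk : c.Linked (raw ω') k
  · rw [addr, addr, if_pos (this.mpr hk), if_pos hk, h k le_rfl]
  · rw [addr, addr, if_neg fun hk' => hk (this.mp hk'), if_neg hk, h k le_rfl]

/-- The earlier digits decide whether a cube is linked, hence whether the bijection between `A j`
and `B j` was applied; it can then be undone level by level. -/
theorem eq_of_addr_eq {ω ω' : c.Code} {k : ℕ} (h : ∀ j < k, addr ω j = addr ω' j) :
    ∀ j < k, ω j = ω' j := by
  intro j
  induction j using Nat.strong_induction_on with
  | _ j ih =>
    intro hj
    have hl : c.Linked (raw ω) j ↔ c.Linked (raw ω') j :=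
      linked_congr fun j' hj' => by rw [raw, raw, ih j' hj' (hj'.trans hj)]
    have := h j hj
    by_cases hk : c.Linked (raw ω') j
    · rw [addr, addr, if_pos (hl.mpr hk), if_pos hk] at this
      exact (Finset.equivOfCardEq (c.card_eq j)).injective (Subtype.ext this)
    · rw [addr, addr, if_neg fun hk' => hk (hl.mp hk'), if_neg hk] at this
      exact Subtype.ext this

theorem continuous_addr [Fintype ι] : Continuous (addr : c.Code → ℕ → ι → Fin L) := by
  refine continuous_pi fun k => continuous_iff_continuousAt.mpr fun ω => ?_
  have h : ∀ᶠ ω' : c.Code in nhds ω, ∀ j ∈ Finset.range (k + 1), ω' j = ω j := by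
    rw [Filter.eventually_all_finset]
    intro j _
    have : ({ω j} : Set (c.A j)) ∈ nhds (ω j) := (isOpen_discrete _).mem_nhds rfl
    exact (continuous_apply j).continuousAt.eventually this
  refine (continuousAt_const (y := addr ω k)).congr ?_
  filter_upwards [h] with ω' hω'
  exact addr_congr fun j hj => (hω' j (Finset.mem_range.mpr (by omega))).symm

theorem range_point_addr : range (fun ω : c.Code => (point (addr ω) : EuclideanSpace ℝ ι)) =
    c.carrier := by
  refine Subset.antisymm ?_ ?_
  · rintro _ ⟨ω, rfl⟩
    exact ⟨addr ω, adm_addr ω, rfl⟩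
  · rintro _ ⟨δ, hδ, rfl⟩
    obtain ⟨ω, rfl⟩ := Adm.exists_code hδ
    exact ⟨ω, rfl⟩

/-- Since `A k` consists of full columns, all values of the vertical digit are equally frequent. -/
theorem card_filter_v_eq_zero (k : ℕ) :
    L * (Finset.univ.filter fun p : c.A k => p.1 c.v = 0).card = (c.A k).card := by
  have h := Finset.card_eq_sum_card_fiberwise (s := (Finset.univ : Finset (c.A k)))
    (t := (Finset.univ : Finset (Fin L))) (f := fun p => p.1 c.v) (fun _ _ => by simp)
  rw [Finset.card_univ, Fintype.card_coe] at h
  rw [h, Finset.sum_congr rfl (g := fun _ =>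
    (Finset.univ.filter fun p : c.A k => p.1 c.v = 0).card)]
  · simp
  · intro y _
    refine Finset.card_nbij'
      (fun p => ⟨Function.update p.1 c.v 0, (c.isPattern k).update_mem _ p.2 _⟩)
      (fun p => ⟨Function.update p.1 c.v y, (c.isPattern k).update_mem _ p.2 _⟩) ?_ ?_ ?_ ?_
    · intro p _; simp
    · intro p _; simp
    · intro p hp
      have : p.1 c.v = y := by simpa using hp
      ext1
      simp [← this]
    · intro p hp
      have : p.1 c.v = 0 := by simpa using hp
      ext1
      simp [← this]

variable [Fintype ι]

theorem isCompact_carrier : IsCompact c.carrier := by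
  rw [← range_point_addr]
  exact isCompact_range (continuous_point.comp continuous_addr)

theorem isCurve_carrier : IsCurve c.carrier :=
  isCurve_of_chainConnected isCompact_carrier ⟨point 0, 0, adm_zero, rfl⟩ chainConnected_carrier
    fun _ hε => exists_finite_chainConnected_cover hε

instance (k : ℕ) : Nonempty (c.A k) := ⟨⟨0, zero_mem_A k⟩⟩

variable (c) in
/-- The uniform probability measure on codes. -/
noncomputable def codeMeasure : Measure c.Code :=
  Measure.infinitePi fun k => (PMF.uniformOfFintype (c.A k)).toMeasure

instance : IsProbabilityMeasure c.codeMeasure := by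
  unfold codeMeasure; infer_instance

theorem codeMeasure_cylinder (ω : c.Code) (k : ℕ) :
    c.codeMeasure {ω' | ∀ j < k, ω' j = ω j} =
      ((∏ j ∈ Finset.range k, (c.A j).card : ℕ) : ℝ≥0∞)⁻¹ := by
  have : {ω' : c.Code | ∀ j < k, ω' j = ω j} =
      Set.pi (Finset.range k : Set ℕ) fun j => {ω j} := by
    ext ω'; simp [Set.mem_pi]
  rw [this, codeMeasure, Measure.infinitePi_pi _ fun j _ => MeasurableSet.singleton _]
  simp only [PMF.toMeasure_apply_singleton _ _ (MeasurableSet.singleton _),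
    PMF.uniformOfFintype_apply, Fintype.card_coe]
  push_cast
  rw [ENNReal.prod_inv_distrib]
  intro i _ j _ _
  right
  exact ENNReal.natCast_ne_top _

theorem measurable_point_addr :
    Measurable fun ω : c.Code => (point (addr ω) : EuclideanSpace ℝ ι) :=
  (continuous_point.comp continuous_addr).measurable

variable (c) in
/-- The natural measure on the carpet. -/
noncomputable def measure : Measure (EuclideanSpace ℝ ι) :=
  c.codeMeasure.map fun ω => point (addr ω)

theorem measure_compl_carrier : c.measure c.carrierᶜ = 0 := by
  rw [measure, Measure.map_apply measurable_point_addr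
    isCompact_carrier.isClosed.measurableSet.compl]
  convert! measure_empty (μ := c.codeMeasure)
  ext ω
  simp only [mem_preimage, mem_compl_iff, mem_empty_iff_false, iff_false, not_not]
  exact ⟨addr ω, adm_addr ω, rfl⟩

theorem uniform_v_eq_zero (k : ℕ) :
    (PMF.uniformOfFintype (c.A k)).toMeasure {p | p.1 c.v = 0} = (L : ℝ≥0∞)⁻¹ := by
  classical
  rw [PMF.toMeasure_uniformOfFintype_apply _ (Set.toFinite _).measurableSet, Fintype.card_coe,
    ← card_filter_v_eq_zero, Fintype.card_subtype]
  have h0 : (Finset.univ.filter fun p : c.A k => p.1 c.v = 0).card ≠ 0 := by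
    intro h
    have h1 := card_filter_v_eq_zero (c := c) k
    rw [h, mul_zero] at h1
    exact (Finset.card_pos.mpr ⟨0, zero_mem_A k⟩).ne h1
  simp only [mem_ofPred_eq]
  push_cast
  rw [ENNReal.div_eq_inv_mul, ENNReal.mul_inv (Or.inr (ENNReal.natCast_ne_top _))
    (Or.inl (ENNReal.natCast_ne_top _)), mul_assoc, ENNReal.inv_mul_cancel
    (by exact_mod_cast h0) (ENNReal.natCast_ne_top _), mul_one]

/-- With positive probability, the coded point lies in no connected cube. -/
theorem codeMeasure_not_linked_pos (hL : 4 ≤ L) :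
    0 < c.codeMeasure {ω | ∀ k, ¬ c.Linked (raw ω) k} := by
  let bad : ℕ → Set c.Code := fun i =>
    Set.pi (Finset.Ico (2 ^ i - 1) (2 ^ (i + 1) - 1) : Set ℕ) fun j => {p | p.1 c.v = 0}
  have hbad : ∀ i, c.codeMeasure (bad i) ≤ ENNReal.ofReal ((1 / 4) ^ (i + 1)) := by
    intro i
    simp only [bad]
    rw [codeMeasure, Measure.infinitePi_pi _ fun j _ => (Set.toFinite _).measurableSet]
    simp only [uniform_v_eq_zero, Finset.prod_const, Nat.card_Ico]
    -- The block has `2 ^ i ≥ i + 1` levels, each of probability `1 / L ≤ 1 / 4`; the resulting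
    -- geometric series sums to `1 / 3 < 1`.
    have hcard : i + 1 ≤ 2 ^ (i + 1) - 1 - (2 ^ i - 1) := by
      have h1 := Nat.lt_two_pow_self (n := i)
      have h2 : 2 ^ (i + 1) = 2 * 2 ^ i := by rw [pow_succ]; ring
      omega
    have hL4 : (L : ℝ≥0∞)⁻¹ ≤ ENNReal.ofReal (1 / 4) := by
      rw [one_div, ENNReal.ofReal_inv_of_pos (by norm_num)]
      refine ENNReal.inv_le_inv.mpr ?_
      rw [ENNReal.ofReal_ofNat]
      exact_mod_cast hL
    have hL1 : ENNReal.ofReal (1 / 4) ≤ 1 := by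
      rw [ENNReal.ofReal_le_one]; norm_num
    calc (L : ℝ≥0∞)⁻¹ ^ (2 ^ (i + 1) - 1 - (2 ^ i - 1))
        ≤ ENNReal.ofReal (1 / 4) ^ (2 ^ (i + 1) - 1 - (2 ^ i - 1)) := by gcongr
      _ ≤ ENNReal.ofReal (1 / 4) ^ (i + 1) := pow_le_pow_right_of_le_one' hL1 hcard
      _ = _ := by rw [ENNReal.ofReal_pow (by norm_num)]
  have hunion : c.codeMeasure (⋃ i, bad i) ≤ ENNReal.ofReal (1 / 3) := by
    refine (measure_iUnion_le _).trans ((ENNReal.tsum_le_tsum hbad).trans ?_)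
    have hsum : HasSum (fun i : ℕ => ((1 : ℝ) / 4) ^ (i + 1)) (1 / 3) := by
      have := (hasSum_geometric_of_lt_one (r := (1 : ℝ) / 4) (by norm_num) (by norm_num)).mul_left
        ((1 : ℝ) / 4)
      convert! this using 1
      · funext i; rw [pow_succ']
      · norm_num
    rw [← ENNReal.ofReal_tsum_of_nonneg (fun i => by positivity) hsum.summable, hsum.tsum_eq]
  have hsub : univ ⊆ {ω : c.Code | ∀ k, ¬ c.Linked (raw ω) k} ∪ ⋃ i, bad i := by
    intro ω _
    by_cases h : ∀ k, ¬ c.Linked (raw ω) k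
    · exact Or.inl h
    · right
      push Not at h
      obtain ⟨k, i, -, hz⟩ := h
      refine mem_iUnion.mpr ⟨i, fun j hj => ?_⟩
      simp only [Finset.coe_Ico, mem_Ico] at hj
      exact hz j hj.1 hj.2
  by_contra hcon
  have h0 : c.codeMeasure {ω | ∀ k, ¬ c.Linked (raw ω) k} = 0 := by simpa using hcon
  have h1 := (measure_mono hsub).trans (measure_union_le (μ := c.codeMeasure) _ _)
  rw [h0, zero_add, measure_univ] at h1
  have h2 := h1.trans hunion
  rw [ENNReal.one_le_ofReal] at h2
  norm_num at h2

theorem measure_closedBall_le {s c₁ : ℝ} (hs : 0 < s) (hc₁ : 0 < c₁)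
    (hcard : ∀ k, c₁ * ((L : ℝ) ^ k) ^ s ≤ (∏ j ∈ Finset.range k, (c.A j).card : ℕ))
    (x : EuclideanSpace ℝ ι) (r : ℝ) (hr : 0 < r) :
    c.measure (Metric.closedBall x r) ≤
      ENNReal.ofReal ((1 + 4 ^ Fintype.card ι * (L : ℝ) ^ s / c₁) * r ^ s) := by
  have hL1 : (1 : ℝ) < L := by exact_mod_cast c.one_lt
  have hL0 : (0 : ℝ) < L := by linarith
  rw [measure, Measure.map_apply measurable_point_addr measurableSet_closedBall]
  have hD : 0 ≤ 4 ^ Fintype.card ι * (L : ℝ) ^ s / c₁ := by positivity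
  rcases le_or_gt 1 r with hr1 | hr1
  · refine prob_le_one.trans ?_
    rw [ENNReal.one_le_ofReal]
    have := Real.one_le_rpow hr1 hs.le
    nlinarith
  · obtain ⟨k, hk1, hk2⟩ := exists_nat_pow_near_of_lt_one hr hr1.le (inv_pos.mpr hL0)
      (inv_lt_one_of_one_lt₀ hL1)
    have hLk : (0 : ℝ) < (L : ℝ) ^ k := by positivity
    have hrk : (L : ℝ) ^ k * r ≤ 1 := by
      rw [inv_pow] at hk2
      calc (L : ℝ) ^ k * r ≤ (L : ℝ) ^ k * ((L : ℝ) ^ k)⁻¹ := mul_le_mul_of_nonneg_left hk2 hLk.le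
        _ = 1 := mul_inv_cancel₀ hLk.ne'
    -- In each coordinate, cubes of level `k` meeting the ball have `digitPos` between `L ^ k * x i
    -- - 2` and `L ^ k * x i + 1`: at most four values.
    let m : ι → ℕ := fun i => ⌈(L : ℝ) ^ k * x i - 2⌉₊
    let box : Finset (ι → ℕ) := Fintype.piFinset fun i => Finset.Icc (m i) (m i + 3)
    have hsub : (fun ω : c.Code => (point (addr ω) : EuclideanSpace ℝ ι)) ⁻¹'
        Metric.closedBall x r ⊆ ⋃ p ∈ box,
          {ω | ∀ i, digitPos (fun j => addr ω j i) k = p i} := by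
      intro ω hω
      refine mem_iUnion₂.mpr ⟨fun i => digitPos (fun j => addr ω j i) k, ?_, fun i => rfl⟩
      refine Fintype.mem_piFinset.mpr fun i => ?_
      have h1 := pow_mul_ofDigits_mem (fun j => addr ω j i) k
      have h2 : |Real.ofDigits (fun j => addr ω j i) - x i| ≤ r := by
        have h3 : dist (point (addr ω)) x ≤ r := hω
        rw [EuclideanSpace.dist_eq] at h3
        refine le_trans ?_ h3
        refine Real.le_sqrt_of_sq_le ?_
        rw [sq_abs]
        have := Finset.single_le_sum (f := fun i => dist ((point (addr ω)) i) (x i) ^ 2)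
          (fun i _ => sq_nonneg _) (Finset.mem_univ i)
        rwa [Real.dist_eq, sq_abs] at this
      rw [abs_le] at h2
      have h4 := mul_le_mul_of_nonneg_left h2.1 hLk.le
      have h5 := mul_le_mul_of_nonneg_left h2.2 hLk.le
      rw [mul_sub] at h4 h5
      have h6 : (L : ℝ) ^ k * -r = -((L : ℝ) ^ k * r) := by ring
      rw [Finset.mem_Icc]
      constructor
      · exact Nat.ceil_le.mpr (by linarith [h1.1, h1.2])
      · have h7 := Nat.le_ceil ((L : ℝ) ^ k * x i - 2)
        have : ((digitPos (fun j => addr ω j i) k : ℕ) : ℝ) ≤ ((m i + 3 : ℕ) : ℝ) := by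
          push_cast
          simp only [m]
          linarith [h1.1, h1.2]
        exact_mod_cast this
    set W := ∏ j ∈ Finset.range k, (c.A j).card with hW
    have hpiece : ∀ p : ι → ℕ,
        c.codeMeasure {ω | ∀ i, digitPos (fun j => addr ω j i) k = p i} ≤ (W : ℝ≥0∞)⁻¹ := by
      intro p
      rcases {ω : c.Code | ∀ i, digitPos (fun j => addr ω j i) k = p i}.eq_empty_or_nonempty with
        h | ⟨ω₀, hω₀⟩
      · rw [h, measure_empty]; exact zero_le
      · rw [← codeMeasure_cylinder ω₀ k]
        refine measure_mono fun ω hω => eq_of_addr_eq fun j hj => ?_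
        funext i
        exact eq_of_digitPos_eq ((hω i).trans (hω₀ i).symm) j hj
    have hWpos : c₁ * ((L : ℝ) ^ k) ^ s ≤ W := hcard k
    have hcW : 0 < c₁ * ((L : ℝ) ^ k) ^ s := by positivity
    have hW0 : (0 : ℝ) < W := hcW.trans_le hWpos
    have hboxcard : box.card = 4 ^ Fintype.card ι := by
      have h4 : ∀ i, m i + 3 + 1 - m i = 4 := fun i => by omega
      simp [box, Fintype.card_piFinset, h4]
    calc c.codeMeasure _ ≤ ∑ p ∈ box, c.codeMeasure
            {ω | ∀ i, digitPos (fun j => addr ω j i) k = p i} :=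
          (measure_mono hsub).trans (measure_biUnion_finset_le _ _)
      _ ≤ ∑ _p ∈ box, (W : ℝ≥0∞)⁻¹ := Finset.sum_le_sum fun p _ => hpiece p
      _ = ENNReal.ofReal (4 ^ Fintype.card ι * (W : ℝ)⁻¹) := by
          rw [Finset.sum_const, hboxcard, nsmul_eq_mul, ENNReal.ofReal_mul (by positivity),
            ENNReal.ofReal_inv_of_pos hW0, ENNReal.ofReal_natCast]
          congr 1
          rw [← ENNReal.ofReal_natCast]
          push_cast
          rfl
      _ ≤ _ := by
          apply ENNReal.ofReal_le_ofReal
          have hle : ((L : ℝ) ^ k)⁻¹ ≤ L * r := by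
            rw [inv_pow, pow_succ, mul_inv] at hk1
            have := mul_lt_mul_of_pos_left hk1 hL0
            field_simp at this ⊢
            linarith
          have h1 : (((L : ℝ) ^ k) ^ s)⁻¹ ≤ (L : ℝ) ^ s * r ^ s := by
            rw [← Real.inv_rpow hLk.le, ← Real.mul_rpow hL0.le hr.le]
            exact Real.rpow_le_rpow (by positivity) hle hs.le
          calc (4 : ℝ) ^ Fintype.card ι * (W : ℝ)⁻¹
              ≤ 4 ^ Fintype.card ι * (c₁ * ((L : ℝ) ^ k) ^ s)⁻¹ := by gcongr
            _ = 4 ^ Fintype.card ι / c₁ * (((L : ℝ) ^ k) ^ s)⁻¹ := by rw [mul_inv]; ring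
            _ ≤ 4 ^ Fintype.card ι / c₁ * ((L : ℝ) ^ s * r ^ s) := by gcongr
            _ = 4 ^ Fintype.card ι * (L : ℝ) ^ s / c₁ * r ^ s := by ring
            _ ≤ _ := by
              refine mul_le_mul_of_nonneg_right ?_ (by positivity)
              linarith

/-- The ball contains a whole cylinder of level `k + 1`, where `L ^ (-k)` is comparable to `r`. -/
theorem le_measure_ball {s c₂ : ℝ} (hs : 0 < s) (hc₂ : 0 < c₂)
    (hcard : ∀ k, ((∏ j ∈ Finset.range k, (c.A j).card : ℕ) : ℝ) ≤ c₂ * ((L : ℝ) ^ k) ^ s)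
    {x : EuclideanSpace ℝ ι} (hx : x ∈ c.carrier) {r : ℝ} (hr : 0 < r) (hr' : r ≤ Fintype.card ι) :
    ENNReal.ofReal ((c₂ * (L * Fintype.card ι : ℝ) ^ s)⁻¹ * r ^ s) ≤ c.measure (Metric.ball x r) := by
  have hL1 : (1 : ℝ) < L := by exact_mod_cast c.one_lt
  have hL0 : (0 : ℝ) < L := by linarith
  have hn : (0 : ℝ) < Fintype.card ι := hr.trans_le hr'
  rw [measure, Measure.map_apply measurable_point_addr measurableSet_ball]
  rw [← range_point_addr] at hx
  obtain ⟨ω, rfl⟩ := hx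
  obtain ⟨k, hk1, hk2⟩ := exists_nat_pow_near_of_lt_one (div_pos hr hn) ((div_le_one hn).mpr hr')
    (inv_pos.mpr hL0) (inv_lt_one_of_one_lt₀ hL1)
  have hsub : {ω' : c.Code | ∀ j < k + 1, ω' j = ω j} ⊆
      (fun ω : c.Code => (point (addr ω) : EuclideanSpace ℝ ι)) ⁻¹'
        Metric.ball (point (addr ω)) r := by
    intro ω' hω'
    have h1 : dist (point (addr ω') : EuclideanSpace ℝ ι) (point (addr ω)) ≤
        Fintype.card ι * ((L : ℝ) ^ (k + 1))⁻¹ :=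
      dist_point_le fun j hj => addr_congr fun j' hj' => hω' j' (by omega)
    refine h1.trans_lt ?_
    rw [lt_div_iff₀ hn, inv_pow] at hk1
    linarith
  refine le_trans ?_ (measure_mono hsub)
  rw [codeMeasure_cylinder]
  set W := ∏ j ∈ Finset.range (k + 1), (c.A j).card with hW
  have hW0 : 0 < W := Finset.prod_pos fun j _ => Finset.card_pos.mpr ⟨0, zero_mem_A j⟩
  have hW0' : (0 : ℝ) < W := by exact_mod_cast hW0
  have hle : (W : ℝ) ≤ c₂ * ((L : ℝ) ^ (k + 1)) ^ s := hcard (k + 1)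
  rw [← ENNReal.ofReal_natCast, ← ENNReal.ofReal_inv_of_pos hW0']
  apply ENNReal.ofReal_le_ofReal
  refine le_trans ?_ (inv_anti₀ hW0' hle)
  have h1 : r ^ s ≤ (Fintype.card ι : ℝ) ^ s * (((L : ℝ) ^ k) ^ s)⁻¹ := by
    rw [← Real.inv_rpow (by positivity), ← Real.mul_rpow hn.le (by positivity)]
    refine Real.rpow_le_rpow hr.le ?_ hs.le
    rw [div_le_iff₀ hn, inv_pow] at hk2
    linarith
  rw [pow_succ, Real.mul_rpow (by positivity) hL0.le, Real.mul_rpow hL0.le hn.le, mul_inv, mul_inv,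
    mul_inv, mul_inv]
  have hns : (0 : ℝ) < (Fintype.card ι : ℝ) ^ s := by positivity
  calc c₂⁻¹ * (((L : ℝ) ^ s)⁻¹ * ((Fintype.card ι : ℝ) ^ s)⁻¹) * r ^ s
      ≤ c₂⁻¹ * (((L : ℝ) ^ s)⁻¹ * ((Fintype.card ι : ℝ) ^ s)⁻¹) *
        ((Fintype.card ι : ℝ) ^ s * (((L : ℝ) ^ k) ^ s)⁻¹) := by gcongr
    _ = c₂⁻¹ * ((((L : ℝ) ^ k) ^ s)⁻¹ * ((L : ℝ) ^ s)⁻¹) := by field_simp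

theorem ediam_carrier_le : Metric.ediam c.carrier ≤ ENNReal.ofReal (Fintype.card ι) := by
  refine Metric.ediam_le fun x hx y hy => ?_
  obtain ⟨δ, hδ, rfl⟩ := hx
  obtain ⟨δ', hδ', rfl⟩ := hy
  rw [edist_dist]
  apply ENNReal.ofReal_le_ofReal
  have := dist_point_le (ι := ι) (δ := δ) (δ' := δ') (k := 0) (by simp)
  simpa using this

end Carpet

/-! ### Points in no linked cube, and failure of Hölder covering -/

namespace Carpet

variable {ι : Type*} [DecidableEq ι] {L : ℕ} [NeZero L] {c : Carpet ι L}

variable (c) in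
/-- The points of the carpet that lie in no connected cube. -/
def fibred : Set (EuclideanSpace ℝ ι) := point '' {δ | c.Adm δ ∧ ∀ k, ¬ c.Linked δ k}

theorem fibred_subset : c.fibred ⊆ c.carrier := by
  rintro _ ⟨δ, ⟨hδ, -⟩, rfl⟩
  exact ⟨δ, hδ, rfl⟩

/-- Horizontal digits in the `A j` are even, so at the first place where they differ they do so by
at least two. -/
theorem inv_pow_le_dist [Fintype ι] {δ δ' : ℕ → ι → Fin L} {k : ℕ} (hδ : ∀ j, δ j ∈ c.A j)
    (hδ' : ∀ j, δ' j ∈ c.A j) (h : ∃ j < k, ∃ i, i ≠ c.v ∧ δ j i ≠ δ' j i) :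
    ((L : ℝ) ^ k)⁻¹ ≤ dist (point δ : EuclideanSpace ℝ ι) (point δ') := by
  classical
  have hL1 : (1 : ℝ) < L := by exact_mod_cast c.one_lt
  obtain ⟨j, hj, i, hi, hne⟩ := h
  have hex : ∃ j, δ j i ≠ δ' j i := ⟨j, hne⟩
  set t := Nat.find hex with ht
  have htk : t + 1 ≤ k := (Nat.find_min' hex hne).trans_lt hj
  have hpre : ∀ j < t, δ j i = δ' j i := fun j hj => not_not.mp (Nat.find_min hex hj)
  have htne : (δ t i : ℕ) ≠ δ' t i := fun h => Nat.find_spec hex (Fin.ext h)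
  obtain ⟨a, ha⟩ := (c.isPattern t).even _ (hδ t) i hi
  obtain ⟨b, hb⟩ := (c.isPattern t).even _ (hδ' t) i hi
  have hcoord : ((L : ℝ) ^ (t + 1))⁻¹ ≤
      |Real.ofDigits (fun j => δ j i) - Real.ofDigits fun j => δ' j i| := by
    rcases lt_or_gt_of_ne htne with h | h
    · exact inv_pow_le_abs_ofDigits_sub hpre (by omega)
    · rw [abs_sub_comm]
      exact inv_pow_le_abs_ofDigits_sub (fun j hj => (hpre j hj).symm) (by omega)
  calc ((L : ℝ) ^ k)⁻¹ ≤ ((L : ℝ) ^ (t + 1))⁻¹ :=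
        inv_anti₀ (by positivity) (pow_le_pow_right₀ hL1.le htk)
    _ ≤ _ := hcoord
    _ = ‖(point δ - point δ' : EuclideanSpace ℝ ι) i‖ := rfl
    _ ≤ ‖(point δ - point δ' : EuclideanSpace ℝ ι)‖ := PiLp.norm_apply_le _ i
    _ = _ := (dist_eq_norm _ _).symm

variable [Fintype ι]

/-- A finely chained part of the fibred points is contained in a thin column, hence small. -/
theorem hausdorffMeasure_le_of_chainIn {s D : ℝ} (hs : 1 < s) (hD : 0 ≤ D)
    (hup : ∀ x r, 0 < r →
      μH[s] (c.carrier ∩ Metric.closedBall x r) ≤ ENNReal.ofReal (D * r ^ s))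
    {A : Set (EuclideanSpace ℝ ι)} (hA : A ⊆ c.fibred) {ρ δ : ℝ} (hδ : 0 < δ) (hδρ : δ ≤ ρ)
    (hδ1 : δ ≤ 1) (hdist : ∀ x ∈ A, ∀ y ∈ A, dist x y ≤ ρ)
    (hchain : ∀ x ∈ A, ∀ y ∈ A, ChainIn A δ x y) :
    μH[s] A ≤ ENNReal.ofReal
      (D * (Fintype.card ι : ℝ) ^ s * (2 + L) * (L : ℝ) ^ (s - 1) * ρ * δ ^ (s - 1)) := by
  have hL1 : (1 : ℝ) < L := by exact_mod_cast c.one_lt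
  have hL0 : (0 : ℝ) < L := by linarith
  have hs0 : 0 < s := by linarith
  have : Nonempty ι := ⟨c.v⟩
  have hn : (0 : ℝ) < Fintype.card ι := by exact_mod_cast Fintype.card_pos
  rcases A.eq_empty_or_nonempty with rfl | ⟨x₀, hx₀⟩
  · simp
  obtain ⟨k, hk1, hk2⟩ := exists_nat_pow_near_of_lt_one hδ hδ1 (inv_pos.mpr hL0)
    (inv_lt_one_of_one_lt₀ hL1)
  set l : ℝ := (L : ℝ)⁻¹ ^ k with hl
  have hl0 : 0 < l := by positivity
  have hlδ : l ≤ L * δ := by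
    rw [pow_succ, ← hl] at hk1
    calc l = L * (l * (L : ℝ)⁻¹) := by field_simp
      _ ≤ L * δ := mul_le_mul_of_nonneg_left hk1.le hL0.le
  have hcol : ∀ x ∈ A, ∀ y ∈ A, ∀ α β : ℕ → ι → Fin L, (c.Adm α ∧ ∀ k, ¬ c.Linked α k) →
      (c.Adm β ∧ ∀ k, ¬ c.Linked β k) → point α = x → point β = y →
      ∀ j < k, ∀ i, i ≠ c.v → α j i = β j i := by
    -- A step shorter than `δ ≤ L ^ (-k)` preserves the horizontal digits below level `k`. The case
    -- `x = y` also shows that they do not depend on the address chosen.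
    have hstep : ∀ x y, dist x y < δ → ∀ α β : ℕ → ι → Fin L, (c.Adm α ∧ ∀ k, ¬ c.Linked α k) →
        (c.Adm β ∧ ∀ k, ¬ c.Linked β k) → point α = x → point β = y →
        ∀ j < k, ∀ i, i ≠ c.v → α j i = β j i := by
      rintro _ _ hxy α β ⟨hα, hα'⟩ ⟨hβ, hβ'⟩ rfl rfl j hj i hi
      by_contra hne
      have := inv_pow_le_dist (fun j => (hα j).2 (hα' j)) (fun j => (hβ j).2 (hβ' j))
        ⟨j, hj, i, hi, hne⟩
      rw [← inv_pow] at this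
      linarith
    intro x hx y hy α β hα hβ hxα hyβ
    have hc := hchain x hx y hy
    clear hy
    induction hc generalizing β with
    | refl => exact hstep x x (by rwa [dist_self]) α β hα hβ hxα hyβ
    | tail _ hab ih =>
      obtain ⟨γ, hγ, hγb⟩ := hA hab.1
      intro j hj i hi
      exact (ih γ hγ hγb j hj i hi).trans (hstep _ _ hab.2.2 γ β hγ hβ hγb hyβ j hj i hi)
  have hhor : ∀ x ∈ A, ∀ y ∈ A, ∀ i, i ≠ c.v → |x i - y i| ≤ l := by
    intro x hx y hy i hi
    obtain ⟨α, hα, hαx⟩ := hA hx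
    obtain ⟨β, hβ, hβy⟩ := hA hy
    have h := hcol x hx y hy α β hα hβ hαx hβy
    rw [← hαx, ← hβy, point_apply, point_apply, hl, inv_pow]
    exact Real.abs_ofDigits_sub_ofDigits_le fun j hj => h j hj i hi
  have hvert : ∀ x ∈ A, |x c.v - x₀ c.v| ≤ ρ := fun x hx =>
    calc |x c.v - x₀ c.v| = ‖(x - x₀) c.v‖ := rfl
      _ ≤ ‖x - x₀‖ := PiLp.norm_apply_le _ _
      _ = dist x x₀ := (dist_eq_norm _ _).symm
      _ ≤ ρ := hdist x hx x₀ hx₀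
  have hρ : 0 < ρ := hδ.trans_le hδρ
  -- The column has height at most `2 * ρ`. It is cut into slabs of height `l`, each contained in a
  -- ball of radius comparable to `l`, of measure of order `l ^ s`.
  set M := ⌊2 * ρ / l⌋₊ with hM
  let slab : ℕ → Set (EuclideanSpace ℝ ι) := fun n => {x | x ∈ A ∧ ⌊(x c.v - x₀ c.v + ρ) / l⌋₊ = n}
  have hcover : A ⊆ ⋃ n ∈ Finset.range (M + 1), slab n := by
    intro x hx
    refine mem_iUnion₂.mpr ⟨_, ?_, hx, rfl⟩
    rw [Finset.mem_range, Nat.lt_succ_iff]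
    apply Nat.floor_le_floor
    have := (abs_le.mp (hvert x hx)).2
    exact div_le_div_of_nonneg_right (by linarith) hl0.le
  have hslab : ∀ n, μH[s] (slab n) ≤ ENNReal.ofReal (D * (Fintype.card ι * l) ^ s) := by
    intro n
    rcases (slab n).eq_empty_or_nonempty with h | ⟨y, hy, hyn⟩
    · rw [h, measure_empty]; exact zero_le
    · refine (measure_mono fun x hx => ?_).trans (hup y (Fintype.card ι * l) (by positivity))
      obtain ⟨hx, hxn⟩ := hx
      refine ⟨fibred_subset (hA hx), EuclideanSpace.dist_le_card_mul hl0.le fun i => ?_⟩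
      by_cases hi : i = c.v
      · subst hi
        have hpos : ∀ z ∈ A, 0 ≤ (z c.v - x₀ c.v + ρ) / l := fun z hz =>
          div_nonneg (by linarith [(abs_le.mp (hvert z hz)).1]) hl0.le
        have h1 := Nat.floor_le (hpos x hx)
        have h2 := Nat.lt_floor_add_one ((x c.v - x₀ c.v + ρ) / l)
        have h3 := Nat.floor_le (hpos y hy)
        have h4 := Nat.lt_floor_add_one ((y c.v - x₀ c.v + ρ) / l)
        rw [hxn] at h1 h2
        rw [hyn] at h3 h4
        rw [le_div_iff₀ hl0] at h1 h3
        rw [div_lt_iff₀ hl0] at h2 h4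
        rw [abs_le]
        constructor <;> linarith
      · exact hhor x hx y hy i hi
  calc μH[s] A ≤ ∑ n ∈ Finset.range (M + 1), μH[s] (slab n) :=
        (measure_mono hcover).trans (measure_biUnion_finset_le _ _)
    _ ≤ ∑ _n ∈ Finset.range (M + 1), ENNReal.ofReal (D * (Fintype.card ι * l) ^ s) :=
        Finset.sum_le_sum fun n _ => hslab n
    _ = ENNReal.ofReal ((M + 1 : ℕ) * (D * (Fintype.card ι * l) ^ s)) := by
        rw [Finset.sum_const, Finset.card_range, nsmul_eq_mul,
          ENNReal.ofReal_mul (Nat.cast_nonneg _), ENNReal.ofReal_natCast]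
    _ ≤ _ := by
        apply ENNReal.ofReal_le_ofReal
        have hM1 : (M : ℝ) ≤ 2 * ρ / l := Nat.floor_le (by positivity)
        have hls : l ^ s = l * l ^ (s - 1) := by
          rw [← Real.rpow_one_add' hl0.le (by linarith)]; congr 1; ring
        have h1 : ((M + 1 : ℕ) : ℝ) * l ^ s ≤ (2 + L) * ρ * (L ^ (s - 1) * δ ^ (s - 1)) := by
          push_cast
          rw [hls, ← mul_assoc, ← Real.mul_rpow hL0.le hδ.le]
          refine mul_le_mul ?_ (Real.rpow_le_rpow hl0.le hlδ (by linarith)) (by positivity)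
            (by positivity)
          have h2 : (M : ℝ) * l ≤ 2 * ρ := by rwa [le_div_iff₀ hl0] at hM1
          have h3 : l ≤ L * ρ := hlδ.trans (mul_le_mul_of_nonneg_left hδρ hL0.le)
          linarith
        rw [Real.mul_rpow hn.le hl0.le]
        calc ((M + 1 : ℕ) : ℝ) * (D * ((Fintype.card ι : ℝ) ^ s * l ^ s))
            = D * (Fintype.card ι : ℝ) ^ s * (((M + 1 : ℕ) : ℝ) * l ^ s) := by ring
          _ ≤ D * (Fintype.card ι : ℝ) ^ s * ((2 + L) * ρ * (L ^ (s - 1) * δ ^ (s - 1))) :=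
            mul_le_mul_of_nonneg_left h1 (by positivity)
          _ = _ := by ring

/-- Only a lower bound for the image measure is used, so measurability of `fibred` plays no role. -/
theorem measure_fibred_pos (hL : 4 ≤ L) : 0 < c.measure c.fibred := by
  refine (codeMeasure_not_linked_pos (c := c) hL).trans_le ?_
  refine le_trans (measure_mono fun ω hω => ?_)
    (Measure.le_map_apply measurable_point_addr.aemeasurable _)
  exact ⟨addr ω, ⟨adm_addr ω, fun k hk => hω k ((linked_addr ω k).mp hk)⟩, rfl⟩

/-- If a Hölder image contained the carpet, `fibred` would be null for `μH[s]`, hence for the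
natural measure by the mass distribution principle, against its positivity. -/
theorem carrier_properties (hL : 4 ≤ L) {s c₁ c₂ : ℝ} (hs : 1 < s) (hc₁ : 0 < c₁) (hc₂ : 0 < c₂)
    (hcard : ∀ k, c₁ * ((L : ℝ) ^ k) ^ s ≤ (∏ j ∈ Finset.range k, (c.A j).card : ℕ) ∧
      ((∏ j ∈ Finset.range k, (c.A j).card : ℕ) : ℝ) ≤ c₂ * ((L : ℝ) ^ k) ^ s) :
    IsAhlforsRegular s c.carrier ∧ ∀ m : ℕ, 1 ≤ m → ∀ Γ : Set (EuclideanSpace ℝ ι),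
      IsHolderImageOfCube m ((m : ℝ) / s).toNNReal Γ → ¬ c.carrier ⊆ Γ := by
  have hs0 : 0 < s := one_pos.trans hs
  have : Nonempty ι := ⟨c.v⟩
  have hn : (0 : ℝ) < Fintype.card ι := by exact_mod_cast Fintype.card_pos
  have hL0 : (0 : ℝ) < L := by
    have : 0 < L := by omega
    exact_mod_cast this
  have hup := fun x r hr => measure_closedBall_le (c := c) hs0 hc₁ (fun k => (hcard k).1) x r hr
  have hlow := fun x (hx : x ∈ c.carrier) r hr hr' =>
    le_measure_ball hs0 hc₂ (fun k => (hcard k).2) hx (r := r) hr hr'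
  have hC : 0 < 1 + 4 ^ Fintype.card ι * (L : ℝ) ^ s / c₁ := by positivity
  have hc : 0 < (c₂ * (L * Fintype.card ι : ℝ) ^ s)⁻¹ := by positivity
  refine ⟨isAhlforsRegular_of_measure hs0 hc hC hn hup hlow measure_compl_carrier
    ediam_carrier_le, ?_⟩
  rintro m hm _ ⟨f, H, hf, rfl⟩ hsub
  have hball := hausdorffMeasure_inter_closedBall_le hs0 hc hC hn hup hlow
  have hzero := hausdorffMeasure_inter_holderImage_eq_zero hm hs (K := c.fibred)
    (C := (1 + 4 ^ Fintype.card ι * (L : ℝ) ^ s / c₁) / (c₂ * (L * Fintype.card ι : ℝ) ^ s)⁻¹ *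
      8 ^ s * (Fintype.card ι : ℝ) ^ s * (2 + L) * (L : ℝ) ^ (s - 1)) (by positivity)
    (fun A hA ρ δ hδ hδρ hδ1 hdist hchain =>
      hausdorffMeasure_le_of_chainIn hs (by positivity) hball hA hδ hδρ hδ1 hdist hchain) hf
  rw [inter_eq_left.mpr (fibred_subset.trans hsub)] at hzero
  have h := le_mul_hausdorffMeasure hs0 hC hup c.fibred
  rw [hzero, mul_zero] at h
  exact (measure_fibred_pos hL).not_ge h

end Carpet

/-! ### Existence of the carpet and conclusion -/

theorem exists_carpet {N : ℕ} (hN : 2 ≤ N) {s : ℝ} (hs1 : 1 < s) (hsN : s < N) :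
    ∃ (L : ℕ) (_ : NeZero L) (c : Carpet (Fin N) L) (c₁ c₂ : ℝ), 4 ≤ L ∧ 0 < c₁ ∧ 0 < c₂ ∧
      ∀ k, c₁ * ((L : ℝ) ^ k) ^ s ≤ (∏ j ∈ Finset.range k, (c.A j).card : ℕ) ∧
        ((∏ j ∈ Finset.range k, (c.A j).card : ℕ) : ℝ) ≤ c₂ * ((L : ℝ) ^ k) ^ s := by
  obtain ⟨M, a, hM, ha, haM, hax, hxa⟩ := exists_scale hs1 hsN
  have hL : 0 < 2 * M := by omega
  have : NeZero (2 * M) := ⟨hL.ne'⟩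
  obtain ⟨α, hα0, hα, hprod⟩ := exists_seq_prod_comparable (by omega : 1 ≤ a) hax hxa
  let v : Fin N := ⟨0, by omega⟩
  have hpat : ∀ k, ∃ A B : Finset (Fin N → Fin (2 * M)), A.card = 2 * M * α k ∧
      B.card = 2 * M * α k ∧ IsPattern v A B ∧ (k ≠ 0 → ∀ i t, Pi.single i t ∈ B) ∧
      (k = 0 → ∀ p ∈ A, ∀ i, i ≠ v → p i = 0) := by
    intro k
    by_cases hk : k = 0
    · obtain ⟨A, hA, hp, hr⟩ := isPattern_column v (L := 2 * M)
      subst hk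
      exact ⟨A, A, by rw [hA, hα0, mul_one], by rw [hA, hα0, mul_one], hp, fun h => absurd rfl h,
        fun _ => hr⟩
    · obtain ⟨h1, h2⟩ := hα k hk
      obtain ⟨A, B, hA, hB, hp, hax⟩ := exists_isPattern v (M := M) (a := α k)
        (by rwa [Fintype.card_fin]) (by rw [Fintype.card_fin]; omega)
        (by rw [Fintype.card_fin]; omega)
      exact ⟨A, B, hA, hB, hp, fun _ => hax, fun h => absurd h hk⟩
  choose A B hA hB hp hax hr using hpat
  refine ⟨2 * M, this, ⟨v, A, B, hp, hax, fun k => (hA k).trans (hB k).symm, hr 0 rfl, by omega⟩,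
    (((2 * M : ℕ) : ℝ) ^ (s - 1))⁻¹, 2, by omega, ?_, by norm_num, fun k => ?_⟩
  · have : (0 : ℝ) < (2 * M : ℕ) := by exact_mod_cast hL
    positivity
  · simp only [hA]
    exact prod_mul_comparable hL hprod k

theorem mainTheorem9 (N : ℕ) (hN : 2 ≤ N) (s : ℝ) (hs : s ∈ Set.Ioo (1 : ℝ) (N : ℝ))
    (m : ℕ) (hm1 : 1 ≤ m) (hm : (m : ℝ) ≤ s) :
    ∃ E : Set (EuclideanSpace ℝ (Fin N)),
      IsCurve E ∧ IsAhlforsRegular s E ∧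
        ∀ Γ : Set (EuclideanSpace ℝ (Fin N)),
          IsHolderImageOfCube m ((m : ℝ) / s).toNNReal Γ → ¬ E ⊆ Γ := by
  obtain ⟨L, _, c, c₁, c₂, hL, hc₁, hc₂, hcard⟩ := exists_carpet hN hs.1 hs.2
  obtain ⟨hreg, hhol⟩ := c.carrier_properties hL hs.1 hc₁ hc₂ hcard
  exact ⟨c.carrier, Carpet.isCurve_carrier, hreg, hhol m hm1⟩
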